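/- Notation. Let $\alpha_0\in\mathbb R$ with $0<|\alpha_0|\le 1$. For $\beta\in\alpha_0\mathbb Z$ let $\mathcal H_\beta$ be the irreducible representation space of the $\mathrm U(1)$-current algebra $[J_m,J_n]=m\,\delta_{m,-n}$, $J_n^*=J_{-n}$, with unit lowest weight vector $\Omega_\beta$, $J_0=\beta$ and $J_n\Omega_\beta=0$ for $n>0$; let $\mathcal H_\beta^{\rm fin}$ be the linear span of the vectors $J_{-n_1}\cdots J_{-n_k}\Omega_\beta$. On $\bigoplus_\beta \mathcal H_\beta$ let $\hat J_n$ be the direct sum of the current modes and $\hat L_n=\frac12\sum_k{:}\hat J_{n-k}\hat J_k{:}$ the direct sum of the Sugawara operators. For $\alpha\in\alpha_0\mathbb Z$, let $c_\alpha$ be the unitary charge shift $\hat J_{-n_1}\cdots \hat J_{-n_k}\Omega_\beta\mapsto \hat J_{-n_1}\cdots \hat J_{-n_k}\Omega_{\beta+\alpha}$ ($n_j>0$), let $E^\pm(\alpha,z)=\exp\bigl(\mp\sum_{n>0}\frac{\alpha \hat J_{\pm n}}{n}z^{\mp n}\bigr)$, and define the modes $Y_{\alpha,s}$, $s\in\mathbb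 R$, by $$Y_\alpha(z)=c_\alpha E^-(\alpha,z)E^+(\alpha,z)z^{\alpha \hat J_0}=\sum_{s\in\mathbb R}Y_{\alpha,s}z^{-s-d},\qquad d=\tfrac{\alpha^2}{2},$$ where $z^{\alpha \hat J_0}=z^{\alpha\beta}$ on $\mathcal H_\beta$. Let $\widetilde{\mathcal H}=\bigoplus_{j\in\mathbb Z}\mathcal H_{j\alpha_0}\otimes\mathcal H_{j\alpha_0}$ (Hilbert space direct sum and tensor product) and let $D=\bigoplus_{j,\rm alg}\mathcal H^{\rm fin}_{j\alpha_0}\otimes_{\rm alg}\mathcal H^{\rm fin}_{j\alpha_0}\subset\widetilde{\mathcal H}$ be the dense subspace of finite vectors. Proposition. Let $\alpha\in\alpha_0\mathbb Z$ with $|\alpha|<\frac1{\sqrt2}$ and let $\lambda\in\mathbb C$. For every $m\in\mathbb Z$, the series in $$V_m=\hat L_m\otimes\mathbb 1-\mathbb 1\otimes\hat L_{-m}+i\lambda m\sum_{k\in\mathbb R,\ \epsilon=\pm1}Y_{\epsilon\alpha,k}\otimes Y_{\epsilon\alpha,-m+k}$$ converges in norm (unconditionally) on every vector of $D$ (only countably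 many terms are non-zero on each $\mathcal H_\beta\otimes\mathcal H_\beta$), so that $V_m$ is a densely defined operator with domain $D$; moreover $D$ is contained in the domain of $V_m^*$. The operators $V_m$ satisfy the Virasoro relations with central charge $c=0$ (the Witt relations) weakly on $D$: for all $m,n\in\mathbb Z$ and all $\Phi,\Psi\in D$, $$\langle V_m^*\Phi,V_n\Psi\rangle-\langle V_n^*\Phi,V_m\Psi\rangle=(m-n)\langle\Phi,V_{m+n}\Psi\rangle .$$ In this weak sense the $V_m$ give a deformation, with parameter $\lambda$, of the time-zero Witt algebra action by the operators $\hat L_m\otimes\mathbb 1-\mathbb 1\otimes\hat L_{-m}$ (the case $\lambda=0$). -/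

import Mathlib

open scoped TensorProduct InnerProductSpace LinearPMap ENNReal

noncomputable section

namespace TimeZero

/-! ### The space of finite vectors of the `U(1)`-current

The vector `J_{-n₁} ⋯ J_{-n_k} Ω` is modelled by the monomial `X_{n₁} ⋯ X_{n_k}`, so that `Ω = 1`,
`J_{-n}` is multiplication by `X_n` and `J_n = n ∂/∂X_n` for `n > 0`. The inner product is the one
for which `⟪Ω, Ω⟫ = 1` and `J_n* = J_{-n}`: monomials with different exponents are orthogonal and
`∏ X_n ^ a_n` has square norm `∏ n ^ a_n (a_n)!`. -/

/-- The finite vectors of one charge sector, spanned by `J_{-n₁} ⋯ J_{-n_k} Ω`. -/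
abbrev Fock : Type := MvPolynomial ℕ+ ℂ

/-- The square norm of the monomial with exponents `a`. -/
def Fock.weight (a : ℕ+ →₀ ℕ) : ℝ := a.prod fun n k => (n : ℝ) ^ k * (k.factorial : ℝ)

theorem Fock.weight_pos (a : ℕ+ →₀ ℕ) : 0 < Fock.weight a :=
  Finset.prod_pos fun n _ => by
    have := n.pos
    positivity

/-- The sesquilinear form on finite vectors. -/
def Fock.form (v w : Fock) : ℂ :=
  ∑ a ∈ v.support, (Fock.weight a : ℂ) * (starRingEnd ℂ (MvPolynomial.coeff a v) * MvPolynomial.coeff a w)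

theorem Fock.form_eq (v w : Fock) (s : Finset (ℕ+ →₀ ℕ)) (hs : v.support ⊆ s) :
    Fock.form v w = ∑ a ∈ s,
      (Fock.weight a : ℂ) * (starRingEnd ℂ (MvPolynomial.coeff a v) * MvPolynomial.coeff a w) := by
  refine Finset.sum_subset hs fun a _ ha => ?_
  have : MvPolynomial.coeff a v = 0 := by
    by_contra h
    exact ha (MvPolynomial.mem_support_iff.2 h)
  simp [this]

/-- The inner product with `⟪Ω, Ω⟫ = 1` and `J_n* = J_{-n}`. -/
@[reducible]
def Fock.core : InnerProductSpace.Core ℂ Fock where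
  inner := Fock.form
  conj_inner_symm v w := by
    change starRingEnd ℂ (Fock.form w v) = Fock.form v w
    rw [Fock.form_eq v w (v.support ∪ w.support) Finset.subset_union_left,
      Fock.form_eq w v (v.support ∪ w.support) Finset.subset_union_right, map_sum]
    refine Finset.sum_congr rfl fun a _ => ?_
    simp [mul_comm]
  re_inner_nonneg v := by
    change 0 ≤ (Fock.form v v).re
    rw [Fock.form_eq v v v.support subset_rfl, Complex.re_sum]
    refine Finset.sum_nonneg fun a _ => ?_
    rw [← Complex.normSq_eq_conj_mul_self, ← Complex.ofReal_mul, Complex.ofReal_re]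
    exact mul_nonneg (Fock.weight_pos a).le (Complex.normSq_nonneg _)
  add_left v w x := by
    change Fock.form (v + w) x = Fock.form v x + Fock.form w x
    rw [Fock.form_eq (v + w) x ((v + w).support ∪ (v.support ∪ w.support))
        Finset.subset_union_left,
      Fock.form_eq v x ((v + w).support ∪ (v.support ∪ w.support))
        (Finset.subset_union_left.trans Finset.subset_union_right),
      Fock.form_eq w x ((v + w).support ∪ (v.support ∪ w.support))
        (Finset.subset_union_right.trans Finset.subset_union_right), ← Finset.sum_add_distrib]
    refine Finset.sum_congr rfl fun a _ => ?_
    simp only [MvPolynomial.coeff_add, map_add]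
    ring
  smul_left v w r := by
    change Fock.form (r • v) w = starRingEnd ℂ r * Fock.form v w
    rw [Fock.form_eq (r • v) w ((r • v).support ∪ v.support) Finset.subset_union_left,
      Fock.form_eq v w ((r • v).support ∪ v.support) Finset.subset_union_right, Finset.mul_sum]
    refine Finset.sum_congr rfl fun a _ => ?_
    simp only [MvPolynomial.coeff_smul, smul_eq_mul, map_mul]
    ring
  definite v hv := by
    change Fock.form v v = 0 at hv
    refine MvPolynomial.ext _ _ fun a => ?_
    rw [MvPolynomial.coeff_zero]
    by_contra ha
    have h0 : ∑ a ∈ v.support, Fock.weight a * Complex.normSq (MvPolynomial.coeff a v) = 0 := by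
      have h1 : Fock.form v v =
          ((∑ a ∈ v.support, Fock.weight a * Complex.normSq (MvPolynomial.coeff a v) : ℝ) : ℂ) := by
        rw [Fock.form_eq v v v.support subset_rfl, Complex.ofReal_sum]
        refine Finset.sum_congr rfl fun b _ => ?_
        rw [Complex.ofReal_mul, Complex.normSq_eq_conj_mul_self]
      rw [h1] at hv
      exact_mod_cast hv
    rw [Finset.sum_eq_zero_iff_of_nonneg fun b _ =>
      mul_nonneg (Fock.weight_pos b).le (Complex.normSq_nonneg _)] at h0
    have h2 := h0 a (MvPolynomial.mem_support_iff.2 ha)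
    rcases mul_eq_zero.1 h2 with h | h
    · exact (Fock.weight_pos a).ne' h
    · exact ha (Complex.normSq_eq_zero.1 h)

instance Fock.instNormedAddCommGroup : NormedAddCommGroup Fock := Fock.core.toNormedAddCommGroup
instance Fock.instInnerProductSpace : InnerProductSpace ℂ Fock := InnerProductSpace.ofCore Fock.core.toCore

theorem Fock.inner_eq (v w : Fock) : ⟪v, w⟫_ℂ = Fock.form v w := rfl

/-- The current mode `J_n` on the finite vectors of charge `β`: `J_0 = β`, `J_n = n ∂/∂X_n` and
`J_{-n} = X_n` for `n > 0`. -/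
def current (β : ℝ) : ℤ → Module.End ℂ Fock
  | Int.ofNat 0 => (β : ℂ) • 1
  | Int.ofNat (n + 1) =>
      ((n + 1 : ℕ) : ℂ) • (MvPolynomial.pderiv (R := ℂ) n.succPNat).toLinearMap
  | Int.negSucc n => LinearMap.mulLeft ℂ (MvPolynomial.X n.succPNat : Fock)

/-! ### Locally finite sums of operators -/

/-- The vectors all of whose monomials `X_{n₁} ⋯ X_{n_k}` satisfy `n₁ + ⋯ + n_k < N`. -/
def levelLT (N : ℕ) : Submodule ℂ Fock where
  carrier := {v | ∀ a : ℕ+ →₀ ℕ, MvPolynomial.coeff a v ≠ 0 → (a.sum fun n k => (n : ℕ) * k) < N}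
  zero_mem' := fun a h => absurd (MvPolynomial.coeff_zero a) h
  add_mem' {v w} hv hw a h := by
    rw [MvPolynomial.coeff_add] at h
    by_cases h1 : MvPolynomial.coeff a v = 0
    · exact hw a (by rwa [h1, zero_add] at h)
    · exact hv a h1
  smul_mem' c v hv a h := hv a fun h0 => h (by rw [MvPolynomial.coeff_smul, h0, smul_zero])

theorem exists_mem_levelLT (v : Fock) : ∃ N, v ∈ levelLT N :=
  ⟨(v.support.sup fun a => a.sum fun n k => (n : ℕ) * k) + 1, fun _ ha =>
    Nat.lt_succ_of_le (Finset.le_sup (f := fun a : ℕ+ →₀ ℕ => a.sum fun n k => (n : ℕ) * k)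
      (MvPolynomial.mem_support_iff.2 ha))⟩

theorem levelLT_zero {v : Fock} (h : v ∈ levelLT 0) : v = 0 :=
  MvPolynomial.ext _ _ fun a => by
    rw [MvPolynomial.coeff_zero]
    by_contra ha
    exact absurd (h a ha) (Nat.not_lt_zero _)

theorem levelLT_mono {M N : ℕ} (h : M ≤ N) : levelLT M ≤ levelLT N :=
  fun _ hv a ha => (hv a ha).trans_le h

theorem current_mem_levelLT (β : ℝ) (n N : ℕ) (hn : n ≠ 0) {v : Fock} (hv : v ∈ levelLT N) :
    current β n v ∈ levelLT (N - n) := by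
  obtain ⟨m, rfl⟩ := Nat.exists_eq_succ_of_ne_zero hn
  intro a ha
  have h1 : MvPolynomial.coeff a (current β (m.succ : ℕ) v) =
      ((m + 1 : ℕ) : ℂ) * (MvPolynomial.coeff (a + Finsupp.single m.succPNat 1)
        v * ((a m.succPNat : ℂ) + 1)) := by
    change MvPolynomial.coeff a (((m + 1 : ℕ) : ℂ) •
      (MvPolynomial.pderiv m.succPNat v)) = _
    rw [MvPolynomial.coeff_smul, MvPolynomial.coeff_pderiv, smul_eq_mul]
  have h2 : MvPolynomial.coeff (a + Finsupp.single m.succPNat 1) v ≠ 0 := by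
    intro h
    apply ha
    rw [h1]
    rw [h, zero_mul, mul_zero]
  have h3 := hv _ h2
  rw [Finsupp.sum_add_index' (by simp) (by intros; ring), Finsupp.sum_single_index (by simp)] at h3
  simp only [Nat.succPNat_coe, mul_one] at h3
  omega

theorem current_eq_zero (β : ℝ) (n : ℤ) (N : ℕ) (hN : (N : ℤ) ≤ n) (hn : 0 < n) {v : Fock}
    (hv : v ∈ levelLT N) : current β n v = 0 := by
  lift n to ℕ using hn.le
  have h := current_mem_levelLT β n N (by omega) hv
  rw [show N - n = 0 by omega] at h
  exact levelLT_zero h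

/-- The sum `∑ k, T k` of a family of operators that is locally finite, that is, such that on each
vector only finitely many of them do not vanish. -/
def locallyFiniteSum {ι : Type} (T : ι → Module.End ℂ Fock)
    (hT : ∀ v, (Function.support fun k => T k v).Finite) : Module.End ℂ Fock where
  toFun v := ∑ᶠ k, T k v
  map_add' v w := by
    simp only [map_add]
    exact finsum_add_distrib (hT v) (hT w)
  map_smul' c v := by
    simp only [map_smul, RingHom.id_apply]
    exact (smul_finsum c _).symm

/-! ### The Sugawara operators -/

/-- The normally ordered product `:J_a J_b:` on the sector of charge `β`: the mode with the larger
index stands on the right. -/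
def normalOrdered (β : ℝ) (a b : ℤ) : Module.End ℂ Fock :=
  if a ≤ b then current β a * current β b else current β b * current β a

theorem normalOrdered_locallyFinite (β : ℝ) (n : ℤ) (v : Fock) :
    (Function.support fun k : ℤ => normalOrdered β (n - k) k v).Finite := by
  obtain ⟨N, hN⟩ := exists_mem_levelLT v
  refine (Set.finite_Icc (n - N - 1) (N + 1 : ℤ)).subset fun k hk => ?_
  by_contra hk'
  apply hk
  rw [Set.mem_Icc, not_and_or, not_le, not_le] at hk'
  change normalOrdered β (n - k) k v = 0
  unfold normalOrdered
  split_ifs with h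
  · rw [Module.End.mul_apply, current_eq_zero β k N (by omega) (by omega) hN, map_zero]
  · rw [Module.End.mul_apply, current_eq_zero β (n - k) N (by omega) (by omega) hN, map_zero]

/-- The Sugawara operator `L_n = ½ ∑ k, :J_{n-k} J_k:` on the sector of charge `β`. -/
def sugawara (β : ℝ) (n : ℤ) : Module.End ℂ Fock :=
  (1 / 2 : ℂ) • locallyFiniteSum (fun k : ℤ => normalOrdered β (n - k) k)
    (normalOrdered_locallyFinite β n)

/-! ### The charged fields -/

/-- The coefficient of `x ^ k` in `exp S = ∑ l, S ^ l / l!`, for a formal power series `S` in `x`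
without constant term (so that `S ^ l` contributes only for `l ≤ k`). -/
def expCoeff (S : PowerSeries (Module.End ℂ Fock)) (k : ℕ) : Module.End ℂ Fock :=
  ∑ l ∈ Finset.range (k + 1), ((l.factorial : ℂ)⁻¹) • PowerSeries.coeff k (S ^ l)

/-- The formal series `∑ n > 0, (c / n) J_{σ n} x ^ n`, for a sign `σ`. The modes `J_{± n}` with
`n > 0` do not depend on the charge of the sector. -/
def exponent (c : ℝ) (σ : ℤ) : PowerSeries (Module.End ℂ Fock) :=
  PowerSeries.mk fun n => if n = 0 then 0 else ((c : ℂ) / n) • current 0 (σ * n)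

/-- The coefficient of `z ^ k` in `E⁻(α, z) = exp (∑ n > 0, (α / n) J_{-n} z ^ n)`. -/
def EMinus (α : ℝ) (k : ℕ) : Module.End ℂ Fock := expCoeff (exponent α (-1)) k

/-- The coefficient of `z ^ (-k)` in `E⁺(α, z) = exp (- ∑ n > 0, (α / n) J_n z ^ (-n))`. -/
def EPlus (α : ℝ) (k : ℕ) : Module.End ℂ Fock := expCoeff (exponent (-α) 1) k

theorem coeff_pow_mem_levelLT (c : ℝ) (l k N : ℕ) {v : Fock} (hv : v ∈ levelLT N) :
    PowerSeries.coeff k (exponent c 1 ^ l) v ∈ levelLT (N - k) := by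
  induction l generalizing k N v with
  | zero =>
    rw [pow_zero, PowerSeries.coeff_one]
    split_ifs with h
    · subst h
      simpa using hv
    · simp
  | succ l ih =>
    rw [pow_succ, PowerSeries.coeff_mul, LinearMap.sum_apply]
    refine Submodule.sum_mem _ fun p hp => ?_
    replace hp := Finset.HasAntidiagonal.mem_antidiagonal.1 hp
    rw [Module.End.mul_apply]
    by_cases h2 : p.2 = 0
    · simp [exponent, h2]
    · have h3 : PowerSeries.coeff p.2 (exponent c 1) v ∈ levelLT (N - p.2) := by
        simp only [exponent, PowerSeries.coeff_mk, h2, if_false, one_mul, LinearMap.smul_apply]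
        exact Submodule.smul_mem _ _ (current_mem_levelLT 0 _ _ h2 hv)
      have h4 := ih p.1 _ h3
      rwa [show N - p.2 - p.1 = N - k by omega] at h4

theorem EPlus_eq_zero (α : ℝ) {k N : ℕ} (h : N ≤ k) {v : Fock} (hv : v ∈ levelLT N) :
    EPlus α k v = 0 := by
  have : EPlus α k v ∈ levelLT (N - k) := by
    unfold EPlus expCoeff
    rw [LinearMap.sum_apply]
    exact Submodule.sum_mem _ fun l _ =>
      Submodule.smul_mem _ _ (coeff_pow_mem_levelLT _ _ _ _ hv)
  rw [show N - k = 0 by omega] at this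
  exact levelLT_zero this

/-- The summands `E⁻_p E⁺_q`, with `q - p = k`, of the coefficient of `z ^ (-k)` in
`E⁻(α, z) E⁺(α, z)`. -/
def vertexTerm (α : ℝ) (k : ℤ) (q : ℕ) : Module.End ℂ Fock :=
  if k ≤ q then EMinus α (q - k).toNat * EPlus α q else 0

theorem vertexTerm_locallyFinite (α : ℝ) (k : ℤ) (v : Fock) :
    (Function.support fun q : ℕ => vertexTerm α k q v).Finite := by
  obtain ⟨N, hN⟩ := exists_mem_levelLT v
  refine (Set.finite_Iio N).subset fun q hq => ?_
  by_contra hq'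
  apply hq
  rw [Set.mem_Iio, not_lt] at hq'
  change vertexTerm α k q v = 0
  unfold vertexTerm
  split_ifs
  · rw [Module.End.mul_apply, EPlus_eq_zero α hq' hN, map_zero]
  · rfl

/-- The coefficient of `z ^ (-k)` in `E⁻(α, z) E⁺(α, z)`. -/
def vertexCoeff (α : ℝ) (k : ℤ) : Module.End ℂ Fock :=
  locallyFiniteSum (vertexTerm α k) (vertexTerm_locallyFinite α k)

/-- The restriction of the mode `Y_{α,s}`, `s ∈ ℝ`, to finite vectors of charge `β`, where
`Y_α(z) = c_α E⁻(α, z) E⁺(α, z) z ^ (α J_0) = ∑ s, Y_{α,s} z ^ (-s-d)` and `d = α² / 2`.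
Since `z ^ (α J_0) = z ^ (α β)`, the mode is the coefficient of `z ^ (-k)` in `E⁻ E⁺` with
`k = s + α β + d` if this is an integer, and zero otherwise. The charge shift `c_α` acts as the
identity of the space `Fock`, by which all sectors are modelled; the change of the
sector is made in `shiftedPair`. -/
def chargedMode (α β s : ℝ) : Module.End ℂ Fock :=
  if (⌊s + α * β + α ^ 2 / 2⌋ : ℝ) = s + α * β + α ^ 2 / 2 then
    vertexCoeff α ⌊s + α * β + α ^ 2 / 2⌋
  else 0

/-! ### The two-dimensional extension -/

/-- The algebraic direct sum over `j ∈ ℤ` of the algebraic tensor squares of the finite vectors of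
charge `j α₀`. -/
abbrev FiniteVectors : Type := ℤ →₀ (Fock ⊗[ℂ] Fock)

/-- The Hilbert space direct sum over `j ∈ ℤ` of the Hilbert space tensor squares of the sectors
of charge `j α₀`. -/
abbrev HilbertSpace : Type := lp (fun _ : ℤ => UniformSpace.Completion (Fock ⊗[ℂ] Fock)) 2

/-- The inclusion of the finite vectors in the Hilbert space. -/
def incl : FiniteVectors →ₗ[ℂ] HilbertSpace :=
  Finsupp.lsum ℂ fun j =>
    (lp.lsingle (𝕜 := ℂ) (E := fun _ : ℤ => UniformSpace.Completion (Fock ⊗[ℂ] Fock)) 2 j) ∘ₗ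
      (UniformSpace.Completion.toComplL (𝕜 := ℂ) (E := Fock ⊗[ℂ] Fock)).toLinearMap

theorem incl_apply (x : FiniteVectors) (i : ℤ) :
    incl x i = ((x i : Fock ⊗[ℂ] Fock) : UniformSpace.Completion (Fock ⊗[ℂ] Fock)) := by
  induction x using Finsupp.induction_linear with
  | zero => rw [map_zero, Finsupp.zero_apply, UniformSpace.Completion.coe_zero]; rfl
  | add f g hf hg =>
    rw [map_add, lp.coeFn_add, Pi.add_apply, hf, hg, Finsupp.add_apply,
      UniformSpace.Completion.coe_add]
  | single j v =>
    rw [incl, Finsupp.lsum_single]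
    change lp.single (E := fun _ : ℤ => UniformSpace.Completion (Fock ⊗[ℂ] Fock)) 2 j
      ((v : Fock ⊗[ℂ] Fock) : UniformSpace.Completion (Fock ⊗[ℂ] Fock)) i = _
    by_cases h : i = j
    · subst h
      rw [lp.single_apply_self, Finsupp.single_eq_same]
    · rw [lp.single_apply_ne _ _ _ h, Finsupp.single_eq_of_ne h, UniformSpace.Completion.coe_zero]

theorem incl_injective : Function.Injective incl := by
  intro x y h
  ext1 i
  have := congrArg (fun w : HilbertSpace => w i) h
  simp only [incl_apply] at this
  exact UniformSpace.Completion.coe_injective _ this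

/-- The operator `L̂_m ⊗ 1 - 1 ⊗ L̂_{-m}` on the finite vectors. -/
def undeformed (α₀ : ℝ) (m : ℤ) : FiniteVectors →ₗ[ℂ] FiniteVectors :=
  Finsupp.lsum ℂ fun j => Finsupp.lsingle j ∘ₗ
    (TensorProduct.map (sugawara (j * α₀) m) LinearMap.id -
      TensorProduct.map LinearMap.id (sugawara (j * α₀) (-m)))

/-- The operator `Y_{α,s} ⊗ Y_{α,t}` on the finite vectors, for `α = l α₀`; it maps the sector of
charge `j α₀` to the sector of charge `(j + l) α₀`. -/
def shiftedPair (α₀ : ℝ) (l : ℤ) (s t : ℝ) : FiniteVectors →ₗ[ℂ] FiniteVectors :=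
  Finsupp.lsum ℂ fun j => Finsupp.lsingle (j + l) ∘ₗ
    TensorProduct.map (chargedMode (l * α₀) (j * α₀) s) (chargedMode (l * α₀) (j * α₀) t)

/-- The terms `Y_{εα,k} ⊗ Y_{εα,-m+k}` of the time-zero field, with `α = l α₀`, `ε = ± 1`, `k ∈ ℝ`,
applied to a finite vector. -/
def timeZeroTerm (α₀ : ℝ) (l m : ℤ) (x : FiniteVectors) (p : ℤˣ × ℝ) : HilbertSpace :=
  incl (shiftedPair α₀ ((p.1 : ℤ) * l) p.2 (-m + p.2) x)

theorem timeZeroTerm_add (α₀ : ℝ) (l m : ℤ) (x y : FiniteVectors) :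
    timeZeroTerm α₀ l m (x + y) = timeZeroTerm α₀ l m x + timeZeroTerm α₀ l m y := by
  funext p
  simp [timeZeroTerm]

theorem timeZeroTerm_smul (α₀ : ℝ) (l m : ℤ) (c : ℂ) (x : FiniteVectors) :
    timeZeroTerm α₀ l m (c • x) = c • timeZeroTerm α₀ l m x := by
  funext p
  simp [timeZeroTerm]

/-- The finite vectors on which the series `∑ k ε, Y_{εα,k} ⊗ Y_{εα,-m+k}` converges
(unconditionally, in norm). -/
def convergenceDomain (α₀ : ℝ) (l m : ℤ) : Submodule ℂ FiniteVectors where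
  carrier := {x | Summable (timeZeroTerm α₀ l m x)}
  zero_mem' := by
    have : timeZeroTerm α₀ l m 0 = 0 := by
      funext p
      simp [timeZeroTerm]
    change Summable _
    rw [this]
    exact summable_zero
  add_mem' {x y} hx hy := by
    change Summable _
    rw [timeZeroTerm_add]
    exact Summable.add hx hy
  smul_mem' c x hx := by
    change Summable _
    rw [timeZeroTerm_smul]
    exact Summable.const_smul c hx

/-- The operator `∑ k ε, Y_{εα,k} ⊗ Y_{εα,-m+k}`, with `α = l α₀`. -/
def timeZeroField (α₀ : ℝ) (l m : ℤ) : convergenceDomain α₀ l m →ₗ[ℂ] HilbertSpace where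
  toFun x := ∑' p, timeZeroTerm α₀ l m x p
  map_add' x y := by
    rw [Submodule.coe_add, timeZeroTerm_add]
    exact Summable.tsum_add x.2 y.2
  map_smul' c x := by
    rw [Submodule.coe_smul, timeZeroTerm_smul]
    exact Summable.tsum_const_smul c x.2

/-- The operator
`L̂_m ⊗ 1 - 1 ⊗ L̂_{-m} + i λ m ∑ k ε, Y_{εα,k} ⊗ Y_{εα,-m+k}`, with `α = l α₀`, as a partially
defined operator in the Hilbert space; its domain consists of the finite vectors on which the
series converges. -/
def deformed (α₀ : ℝ) (l : ℤ) (lam : ℂ) (m : ℤ) : HilbertSpace →ₗ.[ℂ] HilbertSpace where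
  domain := (convergenceDomain α₀ l m).map incl
  toFun :=
    (incl ∘ₗ undeformed α₀ m ∘ₗ (convergenceDomain α₀ l m).subtype +
      (Complex.I * lam * m) • timeZeroField α₀ l m) ∘ₗ
    ((convergenceDomain α₀ l m).equivMapOfInjective incl incl_injective).symm.toLinearMap

/-- The subspace of the finite vectors in the Hilbert space. -/
def finiteDomain : Submodule ℂ HilbertSpace := LinearMap.range incl

/-- The operators `V m`, `m ∈ ℤ`, satisfy the Virasoro relations
`[V m, V n] = (m - n) V (m + n) + (c / 12) m (m² - 1) δ_{m,-n}` weakly on the domain `D`: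
`D` is dense, it is the domain of every `V m` and it lies in the domain of every adjoint
`(V m)†`, and the relations hold when the commutator `[A, B]` is read as the sesquilinear form
`⟪A† Φ, B Ψ⟫ - ⟪B† Φ, A Ψ⟫` on `D`. -/
structure WeakVirasoroRelations {H : Type*} [NormedAddCommGroup H] [InnerProductSpace ℂ H]
    [CompleteSpace H] (c : ℂ) (D : Submodule ℂ H) (V : ℤ → H →ₗ.[ℂ] H) : Prop where
  dense : Dense (D : Set H)
  domain_eq : ∀ m, (V m).domain = D
  le_adjoint : ∀ m, D ≤ (V m)†.domain
  relation : ∀ (m n : ℤ) (Φ Ψ : H) (hΦ : Φ ∈ D) (hΨ : Ψ ∈ D),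
    ⟪(V m)† ⟨Φ, le_adjoint m hΦ⟩, V n ⟨Ψ, (domain_eq n).ge hΨ⟩⟫_ℂ -
        ⟪(V n)† ⟨Φ, le_adjoint n hΦ⟩, V m ⟨Ψ, (domain_eq m).ge hΨ⟩⟫_ℂ =
      ((m : ℂ) - n) * ⟪Φ, V (m + n) ⟨Ψ, (domain_eq (m + n)).ge hΨ⟩⟫_ℂ +
        if m = -n then c / 12 * (m * ((m : ℂ) ^ 2 - 1)) * ⟪Φ, Ψ⟫_ℂ else 0

end TimeZero

end

noncomputable section

namespace TimeZero

/-! ### Current modes -/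

/-! Write V_m = U_m + iλm W_m, where U_m = L_m ⊗ 1 - 1 ⊗ L_{-m} and W_m is the sum of the Y ⊗ Y. The
relations follow from three commutators, each read as a sesquilinear form on D. (1) [U_m, U_n] = (m
- n) U_{m+n} (`undeformed_commutator`). The central term is odd under (m, n) → (-m, -n), so the two
tensor factors cancel it, whatever its value. (2) [U_m, W_n] = ((α² - 1) m - n) W_{m+n}
(`inner_undeformed_totalField`), because each Y_α is primary of dimension α²/2
(`sugawara_vertexCoeff`). With the prefactors iλn and iλm, the terms in α² - 1 cancel between [U_m,
W_n] and [U_n, W_m]; what remains is iλ(m² - n²) W_{m+n} = (m - n) iλ(m + n) W_{m+n}. (3) [W_m, W_n]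
= 0 (`inner_totalField_totalField`), which is locality at time zero. Matrix elements of Y_a(z)
Y_b(w) are a Laurent polynomial times (1 - w/z)^{ab}; in the other order the same polynomial
multiplies (1 - z/w)^{ab} (`isExpansion_inner_vertexCoeff`). In the tensor product, both orders lead
to autocorrelations of one binomial sequence, and these are even functions of the shift. The
coefficients of (1 - x)^{-t} are O(n^{|t| - 1}), hence square summable for |t| < 1/2. With t = ± α²
this is the condition |α| < 1/√2. It gives the autocorrelations in (3), and also the norm
convergence of W_m on D: the terms of the series are almost orthogonal, with summable square norms
(`summable_vertexCoeff_tmul`). The adjoints come from J_n* = J_{-n}, L_m* = L_{-m} and Y_{α,s}* =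
Y_{-α,-s}: on D, V_m* acts as U_{-m} plus the conjugate of iλm times W_{-m}. Identities between
operators on a sector are obtained by moving current modes to the vacuum: a family with prescribed
commutators with all J_n, n ≠ 0, is determined by its vacuum expectation values
(`eq_zero_of_current_commutator`). -/

theorem int_cases_pnat (n : ℤ) : n = 0 ∨ (∃ p : ℕ+, n = (p : ℕ)) ∨ ∃ p : ℕ+, n = -((p : ℕ) : ℤ) := by
  rcases lt_trichotomy n 0 with h | h | h
  · exact Or.inr (Or.inr ⟨⟨(-n).toNat, by omega⟩, by simp; omega⟩)
  · exact Or.inl h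
  · exact Or.inr (Or.inl ⟨⟨n.toNat, by omega⟩, by simp; omega⟩)

theorem current_zero (β : ℝ) (v : Fock) : current β 0 v = (β : ℂ) • v := rfl

theorem current_pos (β : ℝ) (p : ℕ+) (v : Fock) :
    current β (p : ℕ) v = ((p : ℕ) : ℂ) • MvPolynomial.pderiv p v := by
  obtain ⟨p, hp⟩ := p
  obtain ⟨m, rfl⟩ := Nat.exists_eq_succ_of_ne_zero hp.ne'
  rfl

theorem current_neg (β : ℝ) (p : ℕ+) (v : Fock) :
    current β (-((p : ℕ) : ℤ)) v = MvPolynomial.X p * v := by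
  obtain ⟨p, hp⟩ := p
  obtain ⟨m, rfl⟩ := Nat.exists_eq_succ_of_ne_zero hp.ne'
  rfl

theorem current_congr (β β' : ℝ) {n : ℤ} (hn : n ≠ 0) : current β n = current β' n := by
  refine LinearMap.ext fun v => ?_
  rcases int_cases_pnat n with h | ⟨p, rfl⟩ | ⟨p, rfl⟩
  · exact absurd h hn
  · rw [current_pos, current_pos]
  · rw [current_neg, current_neg]

theorem current_one_of_pos (β : ℝ) {n : ℤ} (hn : 0 < n) : current β n 1 = 0 := by
  rcases int_cases_pnat n with h | ⟨p, rfl⟩ | ⟨p, rfl⟩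
  · omega
  · rw [current_pos, MvPolynomial.pderiv_one, smul_zero]
  · have := p.pos
    omega

theorem current_commutator (β : ℝ) (m n : ℤ) (v : Fock) :
    current β m (current β n v) - current β n (current β m v) =
      if m + n = 0 then (m : ℂ) • v else 0 := by
  have key (p q : ℕ+) (v : Fock) :
      current β (p : ℕ) (current β (-((q : ℕ) : ℤ)) v) -
        current β (-((q : ℕ) : ℤ)) (current β (p : ℕ) v) =
        if p = q then ((p : ℕ) : ℂ) • v else 0 := by
    simp only [current_pos, current_neg, Derivation.leibniz, MvPolynomial.pderiv_X, smul_eq_mul,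
      smul_add, mul_smul_comm, add_sub_cancel_left, Pi.single_apply]
    simp only [eq_comm]
    split_ifs with h <;> simp
  rcases int_cases_pnat m with rfl | ⟨p, rfl⟩ | ⟨p, rfl⟩
  · simp [current_zero]
  · rcases int_cases_pnat n with rfl | ⟨q, rfl⟩ | ⟨q, rfl⟩
    · simp [current_zero]
    · have := p.pos
      rw [if_neg (by omega)]
      simp only [current_pos, map_smul]
      have h : MvPolynomial.pderiv p (MvPolynomial.pderiv q v) =
          MvPolynomial.pderiv q (MvPolynomial.pderiv p v) := by
        have : ⁅MvPolynomial.pderiv (R := ℂ) p, MvPolynomial.pderiv (R := ℂ) q⁆ = 0 := by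
          ext i
          simp [Derivation.commutator_apply, MvPolynomial.pderiv_X, Pi.single_apply, apply_ite]
        have := DFunLike.congr_fun this v
        simpa [Derivation.commutator_apply, sub_eq_zero] using this
      rw [h, smul_comm, sub_self]
    · rw [key]
      by_cases h : p = q
      · subst h
        simp
      · rw [if_neg h, if_neg]
        intro h'
        exact h (PNat.coe_injective (by omega))
  · rcases int_cases_pnat n with rfl | ⟨q, rfl⟩ | ⟨q, rfl⟩
    · simp [current_zero]
    · rw [← neg_sub, key]
      by_cases h : p = q
      · subst h
        simp
      · rw [if_neg (fun h' => h h'.symm), if_neg, neg_zero]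
        intro h'
        exact h (PNat.coe_injective (by omega))
    · have := p.pos
      rw [if_neg (by omega)]
      simp only [current_neg]
      ring

/-! ### Adjoints of the current modes and induction from the vacuum. -/

theorem Fock.inner_monomial (a b : ℕ+ →₀ ℕ) (x y : ℂ) :
    ⟪(MvPolynomial.monomial a x : Fock), MvPolynomial.monomial b y⟫_ℂ =
      if a = b then (Fock.weight a : ℂ) * (starRingEnd ℂ x * y) else 0 := by
  rw [Fock.inner_eq, Fock.form_eq _ _ {a} MvPolynomial.support_monomial_subset,
    Finset.sum_singleton, MvPolynomial.coeff_monomial, if_pos rfl, MvPolynomial.coeff_monomial]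
  simp only [eq_comm]
  split_ifs <;> simp

theorem Fock.weight_add_single (a : ℕ+ →₀ ℕ) (p : ℕ+) :
    Fock.weight (a + Finsupp.single p 1) = Fock.weight a * (p * (a p + 1)) := by
  have h1 : ∀ b : ℕ+ →₀ ℕ, Fock.weight b = ((p : ℝ) ^ b p * (b p).factorial) *
      (b.erase p).prod fun n k => (n : ℝ) ^ k * (k.factorial : ℝ) := fun b => by
    rw [Fock.weight, Finsupp.mul_prod_erase' b p (fun n k => (n : ℝ) ^ k * (k.factorial : ℝ)) (by simp)]
  rw [h1, h1 a, Finsupp.erase_add, Finsupp.erase_single, add_zero]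
  simp only [Finsupp.add_apply, Finsupp.single_eq_same, pow_succ, Nat.factorial_succ]
  push_cast
  ring

/-- Adding one factor X_p to a monomial with exponents b multiplies its square norm by p (b_p + 1),
and the derivative produces the factor b_p + 1; the weight is made for this. -/
theorem inner_X_mul (p : ℕ+) (v w : Fock) :
    ⟪v, MvPolynomial.X p * w⟫_ℂ = ((p : ℕ) : ℂ) * ⟪MvPolynomial.pderiv p v, w⟫_ℂ := by
  induction v using MvPolynomial.induction_on' with
  | add v₁ v₂ h₁ h₂ => rw [inner_add_left, h₁, h₂, map_add, inner_add_left, mul_add]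
  | monomial a x =>
    induction w using MvPolynomial.induction_on' with
    | add v₁ v₂ h₁ h₂ => rw [mul_add, inner_add_right, h₁, h₂, inner_add_right, mul_add]
    | monomial b y =>
      rw [MvPolynomial.X, MvPolynomial.monomial_mul, MvPolynomial.pderiv_monomial,
        Fock.inner_monomial, Fock.inner_monomial, one_mul]
      by_cases h : a = Finsupp.single p 1 + b
      · subst h
        rw [if_pos rfl, add_tsub_cancel_left, if_pos rfl, add_comm, Fock.weight_add_single]
        simp
        ring
      · rw [if_neg h]
        by_cases h0 : a p = 0
        · simp [h0]
        · rw [if_neg, mul_zero]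
          intro h'
          apply h
          rw [← h', add_tsub_cancel_of_le]
          rw [Finsupp.single_le_iff]
          omega

theorem inner_current_right (β : ℝ) (n : ℤ) (v w : Fock) :
    ⟪v, current β n w⟫_ℂ = ⟪current β (-n) v, w⟫_ℂ := by
  rcases int_cases_pnat n with rfl | ⟨p, rfl⟩ | ⟨p, rfl⟩
  · rw [neg_zero, current_zero, current_zero, inner_smul_left, inner_smul_right, Complex.conj_ofReal]
  · rw [current_pos, current_neg, inner_smul_right, ← inner_conj_symm (MvPolynomial.X p * v),
      inner_X_mul, map_mul, inner_conj_symm]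
    simp
  · rw [neg_neg, current_pos, current_neg, inner_X_mul, inner_smul_left]
    simp

theorem inner_current_left (β : ℝ) (n : ℤ) (v w : Fock) :
    ⟪current β n v, w⟫_ℂ = ⟪v, current β (-n) w⟫_ℂ := by
  rw [inner_current_right, neg_neg]

theorem inner_one_one : ⟪(1 : Fock), 1⟫_ℂ = 1 := by
  change ⟪(MvPolynomial.monomial 0 1 : Fock), MvPolynomial.monomial 0 1⟫_ℂ = 1
  rw [Fock.inner_monomial]
  simp [Fock.weight]

/-- Induction over pairs of finite vectors, in which the current modes are moved from the right
vector to the left vector and then back to the vacuum. -/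
theorem pair_induction {P : Fock → Fock → Prop} (one : P 1 1)
    (add_left : ∀ v₁ v₂ w, P v₁ w → P v₂ w → P (v₁ + v₂) w)
    (add_right : ∀ v w₁ w₂, P v w₁ → P v w₂ → P v (w₁ + w₂))
    (smul_left : ∀ (c : ℂ) v w, P v w → P (c • v) w)
    (smul_right : ∀ (c : ℂ) v w, P v w → P v (c • w))
    (current_right : ∀ (n : ℤ) v w, n < 0 → P v w → P (current 0 (-n) v) w → P v (current 0 n w))
    (current_left : ∀ (n : ℤ) v, n < 0 → P v 1 → P (current 0 n v) 1) (v w : Fock) : P v w := by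
  have hC (c : ℂ) : (MvPolynomial.C c : Fock) = c • 1 := by
    rw [MvPolynomial.smul_eq_C_mul, mul_one]
  have hX (p : ℕ+) (f : Fock) : f * MvPolynomial.X p = current 0 (-((p : ℕ) : ℤ)) f := by
    rw [current_neg, mul_comm]
  have hp (p : ℕ+) : -((p : ℕ) : ℤ) < 0 := by have := p.pos; omega
  induction w using MvPolynomial.induction_on generalizing v with
  | C c =>
    rw [hC]
    refine smul_right c v 1 ?_
    induction v using MvPolynomial.induction_on with
    | C c => rw [hC]; exact smul_left c 1 1 one
    | add v₁ v₂ h₁ h₂ => exact add_left _ _ _ h₁ h₂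
    | mul_X f p h => rw [hX]; exact current_left _ _ (hp p) h
  | add w₁ w₂ h₁ h₂ => exact add_right _ _ _ (h₁ v) (h₂ v)
  | mul_X f p h => rw [hX]; exact current_right _ _ _ (hp p) (h v) (h _)

/-! ### Exponentials of formal series of operators -/

theorem coeff_pow_eq_zero_of_lt {R : Type*} [Semiring R] {S : PowerSeries R}
    (hS : PowerSeries.coeff 0 S = 0) {k l : ℕ} (h : k < l) : PowerSeries.coeff k (S ^ l) = 0 := by
  induction l generalizing k with
  | zero => omega
  | succ l ih =>
    rw [pow_succ, PowerSeries.coeff_mul]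
    refine Finset.sum_eq_zero fun p hp => ?_
    replace hp := Finset.HasAntidiagonal.mem_antidiagonal.1 hp
    by_cases h2 : p.2 = 0
    · rw [h2, hS, mul_zero]
    · rw [ih (by omega), zero_mul]

/-- Free choice of the cutoff allows coefficients of different degrees to be compared over one
range. -/
theorem expCoeff_eq_sum (S : PowerSeries (Module.End ℂ Fock)) (hS : PowerSeries.coeff 0 S = 0)
    {k K : ℕ} (h : k < K) :
    expCoeff S k = ∑ l ∈ Finset.range K, ((l.factorial : ℂ)⁻¹) • PowerSeries.coeff k (S ^ l) := by
  refine Finset.sum_subset (Finset.range_subset_range.2 h) fun l _ hl => ?_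
  rw [coeff_pow_eq_zero_of_lt hS (by simpa using hl), smul_zero]

theorem expCoeff_zero (S : PowerSeries (Module.End ℂ Fock)) : expCoeff S 0 = 1 := by
  simp [expCoeff]

/-- The hypothesis says [D, S] = γ xⁿ, which is central, so that [D, S^{l+1}] = (l + 1) γ xⁿ S^l. -/
theorem coeff_commutator_pow {D : Module.End ℂ Fock} {S : PowerSeries (Module.End ℂ Fock)} {n : ℕ}
    {γ : ℂ} (h : ∀ r, D * PowerSeries.coeff r S - PowerSeries.coeff r S * D =
      if r = n then γ • 1 else 0) (l k : ℕ) :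
    D * PowerSeries.coeff k (S ^ (l + 1)) - PowerSeries.coeff k (S ^ (l + 1)) * D =
      if n ≤ k then ((l + 1 : ℂ) * γ) • PowerSeries.coeff (k - n) (S ^ l) else 0 := by
  have hS : PowerSeries.C D * S = S * PowerSeries.C D + PowerSeries.X ^ n * PowerSeries.C (γ • 1) := by
    ext1 r
    rw [map_add, PowerSeries.coeff_C_mul, PowerSeries.coeff_mul_C, PowerSeries.coeff_mul_C,
      PowerSeries.coeff_X_pow, ← sub_eq_iff_eq_add', h]
    split_ifs <;> simp
  have hcomm : ∀ T : PowerSeries (Module.End ℂ Fock),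
      PowerSeries.C (γ • (1 : Module.End ℂ Fock)) * T = T * PowerSeries.C (γ • 1) := fun T => by
    ext1 r
    rw [PowerSeries.coeff_C_mul, PowerSeries.coeff_mul_C]
    simp
  have hpow : ∀ l : ℕ, PowerSeries.C D * S ^ (l + 1) = S ^ (l + 1) * PowerSeries.C D +
      (l + 1) • (PowerSeries.X ^ n * (S ^ l * PowerSeries.C (γ • 1))) := by
    intro l
    induction l with
    | zero => simpa using hS
    | succ l ih =>
      rw [pow_succ, ← mul_assoc, ih, add_mul, mul_assoc, hS, mul_add, ← mul_assoc, ← mul_assoc,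
        (PowerSeries.commute_X_pow (S ^ (l + 1)) n).eq, smul_mul_assoc, mul_assoc,
        mul_assoc, mul_assoc (PowerSeries.X ^ n), mul_assoc (S ^ l), hcomm S, ← mul_assoc (S ^ l),
        ← pow_succ, add_assoc, succ_nsmul' _ (l + 1)]
  have := congrArg (PowerSeries.coeff k) (hpow l)
  rw [map_add, PowerSeries.coeff_C_mul, PowerSeries.coeff_mul_C, ← sub_eq_iff_eq_add'] at this
  rw [this, map_nsmul, PowerSeries.coeff_X_pow_mul']
  split_ifs
  · rw [PowerSeries.coeff_mul_C, ← Nat.cast_smul_eq_nsmul ℂ, mul_smul]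
    simp
  · simp

theorem smul_commutator (c : ℂ) (D T : Module.End ℂ Fock) :
    D * c • T - c • T * D = c • (D * T - T * D) := by
  rw [mul_smul_comm, smul_mul_assoc, smul_sub]

/-- This is [D, exp S] = γ xⁿ exp S for central [D, S] = γ xⁿ. -/
theorem expCoeff_commutator {D : Module.End ℂ Fock} {S : PowerSeries (Module.End ℂ Fock)} {n : ℕ}
    {γ : ℂ} (hS : PowerSeries.coeff 0 S = 0) (h : ∀ r, D * PowerSeries.coeff r S -
      PowerSeries.coeff r S * D = if r = n then γ • 1 else 0) (k : ℕ) :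
    D * expCoeff S k - expCoeff S k * D = if n ≤ k then γ • expCoeff S (k - n) else 0 := by
  -- One term more than in the definition: the commutator lowers the power of S by one, and the term
  -- l = 0 drops out.
  rw [expCoeff_eq_sum S hS (show k < k + 1 + 1 by omega), Finset.mul_sum, Finset.sum_mul,
    ← Finset.sum_sub_distrib, Finset.sum_range_succ']
  simp only [smul_commutator, coeff_commutator_pow h]
  have h0 : D * PowerSeries.coeff k (S ^ 0) - PowerSeries.coeff k (S ^ 0) * D = 0 := by
    rw [pow_zero, PowerSeries.coeff_one]
    split_ifs <;> simp
  rw [h0, smul_zero, add_zero]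
  split_ifs with hk
  · rw [expCoeff_eq_sum S hS (show k - n < k + 1 by omega), Finset.smul_sum]
    refine Finset.sum_congr rfl fun l _ => ?_
    rw [smul_smul, smul_smul]
    congr 1
    have : (l.factorial : ℂ) ≠ 0 := by exact_mod_cast l.factorial_ne_zero
    rw [Nat.factorial_succ]
    push_cast
    field_simp
  · simp

/-- Leibniz rule for the Euler operator x d/dx, which multiplies the coefficient of x^r by r. -/
theorem coeff_derivative_mul {R : Type*} [Semiring R] (S T : PowerSeries R) (k : ℕ) :
    k • PowerSeries.coeff k (S * T) =
      PowerSeries.coeff k (PowerSeries.mk (fun r => r • PowerSeries.coeff r S) * T) +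
      PowerSeries.coeff k (S * PowerSeries.mk (fun r => r • PowerSeries.coeff r T)) := by
  simp only [PowerSeries.coeff_mul, PowerSeries.coeff_mk, ← Finset.sum_add_distrib,
    Finset.smul_sum]
  refine Finset.sum_congr rfl fun p hp => ?_
  rw [← Finset.HasAntidiagonal.mem_antidiagonal.1 hp, add_smul, smul_mul_assoc, mul_smul_comm]

theorem coeff_derivative_pow {R : Type*} [Semiring R] {S : PowerSeries R}
    (hS : Commute S (PowerSeries.mk (fun r => r • PowerSeries.coeff r S))) (l k : ℕ) :
    k • PowerSeries.coeff k (S ^ (l + 1)) =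
      (l + 1) • PowerSeries.coeff k (PowerSeries.mk (fun r => r • PowerSeries.coeff r S) * S ^ l) := by
  set T := PowerSeries.mk (fun r => r • PowerSeries.coeff r S) with hT
  have : PowerSeries.mk (fun r => r • PowerSeries.coeff r (S ^ (l + 1))) = (l + 1) • (T * S ^ l) := by
    induction l with
    | zero => simp [T]
    | succ l ih =>
      ext1 k
      rw [PowerSeries.coeff_mk, pow_succ, coeff_derivative_mul, ih, ← map_add, ← hT,
        (hS.pow_left (l + 1)).eq, smul_mul_assoc, mul_assoc, ← pow_succ, ← succ_nsmul]
  have := congrArg (PowerSeries.coeff k) this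
  rwa [PowerSeries.coeff_mk, map_nsmul] at this

/-- The differential equation x (exp S)' = x S' exp S, valid because S commutes with x S'. -/
theorem expCoeff_recursion {S : PowerSeries (Module.End ℂ Fock)} (h0 : PowerSeries.coeff 0 S = 0)
    (hS : Commute S (PowerSeries.mk (fun r => r • PowerSeries.coeff r S))) (k : ℕ) :
    k • expCoeff S k = ∑ p ∈ Finset.HasAntidiagonal.antidiagonal k, (p.1 • PowerSeries.coeff p.1 S) * expCoeff S p.2 := by
  rw [expCoeff_eq_sum S h0 (show k < k + 1 + 1 by omega), Finset.smul_sum, Finset.sum_range_succ']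
  have hz : k • (((Nat.factorial 0 : ℕ) : ℂ)⁻¹ • PowerSeries.coeff k (S ^ 0)) = 0 := by
    rw [pow_zero, PowerSeries.coeff_one]
    split_ifs with h <;> simp [h]
  rw [hz, add_zero]
  have hE : ∀ p ∈ Finset.HasAntidiagonal.antidiagonal k, (p.1 • PowerSeries.coeff p.1 S) * expCoeff S p.2 =
      ∑ l ∈ Finset.range (k + 1), ((l.factorial : ℂ)⁻¹) •
        ((p.1 • PowerSeries.coeff p.1 S) * PowerSeries.coeff p.2 (S ^ l)) := fun p hp => by
    replace hp := Finset.HasAntidiagonal.mem_antidiagonal.1 hp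
    rw [expCoeff_eq_sum S h0 (show p.2 < k + 1 by omega), Finset.mul_sum]
    simp only [mul_smul_comm]
  rw [Finset.sum_congr rfl hE, Finset.sum_comm]
  refine Finset.sum_congr rfl fun l _ => ?_
  rw [smul_comm, coeff_derivative_pow hS, ← Finset.smul_sum, PowerSeries.coeff_mul,
    ← Nat.cast_smul_eq_nsmul ℂ, smul_smul]
  simp only [PowerSeries.coeff_mk]
  congr 1
  have : (l.factorial : ℂ) ≠ 0 := by exact_mod_cast l.factorial_ne_zero
  rw [Nat.factorial_succ]
  push_cast
  field_simp

/-! ### The modes of the charged fields -/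

theorem coeff_zero_exponent (c : ℝ) (σ : ℤ) : PowerSeries.coeff 0 (exponent c σ) = 0 := by
  simp [exponent]

theorem coeff_exponent (c : ℝ) (σ : ℤ) {n : ℕ} (hn : n ≠ 0) :
    PowerSeries.coeff n (exponent c σ) = ((c : ℂ) / n) • current 0 (σ * n) := by
  simp [exponent, hn]

theorem current_mul_current (m n : ℤ) :
    current 0 m * current 0 n - current 0 n * current 0 m =
      if m + n = 0 then (m : ℂ) • (1 : Module.End ℂ Fock) else 0 := by
  refine LinearMap.ext fun v => ?_
  have := current_commutator 0 m n v
  rw [LinearMap.sub_apply, Module.End.mul_apply, Module.End.mul_apply, this]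
  split_ifs <;> rfl

/-- Both exponents are covered by a sign σ. The denominator n in the exponent cancels the factor n
in [J_n, J_{-n}] = n. -/
theorem exponent_commutator (c : ℝ) (σ : ℤ) (hσ : σ * σ = 1) (n : ℕ) (hn : n ≠ 0) (r : ℕ) :
    current 0 (-(σ * n)) * PowerSeries.coeff r (exponent c σ) -
      PowerSeries.coeff r (exponent c σ) * current 0 (-(σ * n)) =
      if r = n then (-(σ : ℂ) * c) • 1 else 0 := by
  by_cases hr : r = 0
  · subst hr
    rw [coeff_zero_exponent, mul_zero, zero_mul, sub_zero, if_neg (fun h => hn h.symm)]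
  · rw [coeff_exponent c σ hr, smul_commutator, current_mul_current]
    by_cases h : r = n
    · subst h
      rw [if_pos (by ring), if_pos rfl, smul_smul]
      congr 1
      have : (r : ℂ) ≠ 0 := by exact_mod_cast hr
      push_cast
      field_simp
    · rw [if_neg h, if_neg, smul_zero]
      intro h'
      have h2 : σ * (-(σ * n) + σ * r) = 0 := by rw [h', mul_zero]
      have h3 : σ * (-(σ * n) + σ * r) = (σ * σ) * (r - n) := by ring
      rw [h3, hσ, one_mul] at h2
      omega

theorem exponent_commutator_same (c : ℝ) (σ : ℤ) (hσ : σ * σ = 1) (n : ℕ) (r : ℕ) :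
    current 0 (σ * n) * PowerSeries.coeff r (exponent c σ) -
      PowerSeries.coeff r (exponent c σ) * current 0 (σ * n) = 0 := by
  by_cases hr : r = 0
  · subst hr
    rw [coeff_zero_exponent, mul_zero, zero_mul, sub_zero]
  · rw [coeff_exponent c σ hr, smul_commutator, current_mul_current,
      if_neg, smul_zero]
    rw [← mul_add, mul_eq_zero]
    rintro (h | h)
    · simp [h] at hσ
    · omega

/-- The coefficient of `z ^ j` in `E⁻(α, z)`, for an integer `j`. -/
def EMinusInt (α : ℝ) (j : ℤ) : Module.End ℂ Fock := if 0 ≤ j then EMinus α j.toNat else 0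

/-- The coefficient of `z ^ (-j)` in `E⁺(α, z)`, for an integer `j`. -/
def EPlusInt (α : ℝ) (j : ℤ) : Module.End ℂ Fock := if 0 ≤ j then EPlus α j.toNat else 0

/-- The coefficient of `x ^ j` in the exponential of a formal series, for an integer `j`. -/
def expCoeffInt (S : PowerSeries (Module.End ℂ Fock)) (j : ℤ) : Module.End ℂ Fock :=
  if 0 ≤ j then expCoeff S j.toNat else 0

/-- Extension by zero to negative degrees removes the case distinction, so that later sums can be
shifted freely. -/
theorem expCoeffInt_commutator {D : Module.End ℂ Fock} {S : PowerSeries (Module.End ℂ Fock)} {n : ℕ}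
    {γ : ℂ} (hS : PowerSeries.coeff 0 S = 0) (h : ∀ r, D * PowerSeries.coeff r S -
      PowerSeries.coeff r S * D = if r = n then γ • 1 else 0) (j : ℤ) :
    D * expCoeffInt S j - expCoeffInt S j * D = γ • expCoeffInt S (j - n) := by
  unfold expCoeffInt
  by_cases hj : 0 ≤ j
  · lift j to ℕ using hj
    rw [if_pos (by omega), Int.toNat_natCast, expCoeff_commutator hS h]
    by_cases hn : n ≤ j
    · rw [if_pos hn, if_pos (by omega)]
      congr 2
      omega
    · rw [if_neg hn, if_neg (by omega), smul_zero]
  · rw [if_neg hj, if_neg (by omega)]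
    simp

theorem current_pos_EMinusInt (α : ℝ) (n : ℕ) (hn : n ≠ 0) (j : ℤ) (v : Fock) :
    current 0 n (EMinusInt α j v) = EMinusInt α j (current 0 n v) + (α : ℂ) • EMinusInt α (j - n) v := by
  have := expCoeffInt_commutator (coeff_zero_exponent α (-1))
    (exponent_commutator α (-1) (by norm_num) n hn) j
  rw [sub_eq_iff_eq_add'] at this
  have := congrArg (fun T : Module.End ℂ Fock => T v) this
  simp [Module.End.mul_apply] at this
  exact this

theorem current_neg_EMinusInt (α : ℝ) (n : ℕ) (j : ℤ) (v : Fock) :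
    current 0 (-n) (EMinusInt α j v) = EMinusInt α j (current 0 (-n) v) := by
  have := expCoeffInt_commutator (n := 0) (γ := 0) (coeff_zero_exponent α (-1)) (fun r => by
    rw [exponent_commutator_same α (-1) (by norm_num) n r]; simp) j
  rw [sub_eq_iff_eq_add'] at this
  have := congrArg (fun T : Module.End ℂ Fock => T v) this
  simp [Module.End.mul_apply] at this
  exact this

theorem current_neg_EPlusInt (α : ℝ) (n : ℕ) (hn : n ≠ 0) (j : ℤ) (v : Fock) :
    current 0 (-n) (EPlusInt α j v) = EPlusInt α j (current 0 (-n) v) + (α : ℂ) • EPlusInt α (j - n) v := by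
  have := expCoeffInt_commutator (coeff_zero_exponent (-α) 1)
    (exponent_commutator (-α) 1 (by norm_num) n hn) j
  rw [sub_eq_iff_eq_add'] at this
  have := congrArg (fun T : Module.End ℂ Fock => T v) this
  simp [Module.End.mul_apply] at this
  exact this

theorem current_pos_EPlusInt (α : ℝ) (n : ℕ) (j : ℤ) (v : Fock) :
    current 0 n (EPlusInt α j v) = EPlusInt α j (current 0 n v) := by
  have := expCoeffInt_commutator (n := 0) (γ := 0) (coeff_zero_exponent (-α) 1) (fun r => by
    rw [exponent_commutator_same (-α) 1 (by norm_num) n r]; simp) j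
  rw [sub_eq_iff_eq_add'] at this
  have := congrArg (fun T : Module.End ℂ Fock => T v) this
  simp [Module.End.mul_apply] at this
  exact this

theorem EPlusInt_eq_zero (α : ℝ) {j : ℤ} {N : ℕ} (h : (N : ℤ) ≤ j) {v : Fock} (hv : v ∈ levelLT N) :
    EPlusInt α j v = 0 := by
  rw [EPlusInt, if_pos (by omega), EPlus_eq_zero α (show N ≤ j.toNat by omega) hv]

theorem vertexSummand_finite (α : ℝ) (k : ℤ) (v : Fock) :
    (Function.support fun q : ℤ => EMinusInt α (q - k) (EPlusInt α q v)).Finite := by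
  obtain ⟨N, hN⟩ := exists_mem_levelLT v
  refine (Set.finite_Ico 0 (N : ℤ)).subset fun q hq => ?_
  by_contra hq'
  apply hq
  rw [Set.mem_Ico, not_and_or, not_le, not_lt] at hq'
  rcases hq' with h | h
  · simp [EPlusInt, show ¬ 0 ≤ q by omega]
  · simp [EPlusInt_eq_zero α h hN]

/-- Summation over all of ℤ allows translation of the index, at no cost because E⁺ vanishes in
negative degree. -/
theorem vertexCoeff_apply (α : ℝ) (k : ℤ) (v : Fock) :
    vertexCoeff α k v = ∑ᶠ q : ℤ, EMinusInt α (q - k) (EPlusInt α q v) := by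
  have h1 : vertexCoeff α k v = ∑ᶠ q : ℕ, EMinusInt α (q - k) (EPlusInt α q v) := by
    change ∑ᶠ q, vertexTerm α k q v = _
    refine finsum_congr fun q => ?_
    unfold vertexTerm EMinusInt EPlusInt
    by_cases h : k ≤ q
    · rw [if_pos h, if_pos (by omega), if_pos (by omega)]
      rfl
    · rw [if_neg h, if_neg (by omega)]
      rfl
  rw [h1, ← finsum_mem_range (f := fun q : ℤ => EMinusInt α (q - k) (EPlusInt α q v))
    Nat.cast_injective, ← finsum_mem_univ (f := fun q : ℤ => EMinusInt α (q - k) (EPlusInt α q v))]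
  refine (finsum_mem_inter_support_eq' _ _ _ fun q hq => ?_).symm
  simp only [Set.mem_univ, Set.mem_range, true_iff]
  by_contra h
  apply hq
  have : ¬ 0 ≤ q := fun h0 => h ⟨q.toNat, by omega⟩
  simp [EPlusInt, this]

theorem vertexCoeff_eq_zero (α : ℝ) {k : ℤ} {N : ℕ} (h : (N : ℤ) ≤ k) {v : Fock}
    (hv : v ∈ levelLT N) : vertexCoeff α k v = 0 := by
  rw [vertexCoeff_apply]
  refine finsum_eq_zero_of_forall_eq_zero fun q => ?_
  by_cases hq : (N : ℤ) ≤ q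
  · rw [EPlusInt_eq_zero α hq hv, map_zero]
  · rw [EMinusInt, if_neg (by omega)]
    rfl

/-- `[J_n, Y_α(z)] = α z ^ n Y_α(z)` -/
theorem current_vertexCoeff (α β : ℝ) (n k : ℤ) (v : Fock) :
    current (β + α) n (vertexCoeff α k v) =
      vertexCoeff α k (current β n v) + (α : ℂ) • vertexCoeff α (k + n) v := by
  by_cases hn : n = 0
  · subst hn
    rw [current_zero, current_zero, map_smul, add_zero, ← add_smul]
    push_cast
    rfl
  rw [current_congr (β + α) 0 hn, current_congr β 0 hn]
  have hmap : current 0 n (vertexCoeff α k v) =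
      ∑ᶠ q : ℤ, current 0 n (EMinusInt α (q - k) (EPlusInt α q v)) := by
    rw [vertexCoeff_apply]
    exact (current 0 n).toAddMonoidHom.map_finsum (vertexSummand_finite α k v)
  -- For n < 0 the mode commutes with E⁻ and the extra term comes from E⁺, which calls for a
  -- translation of q; for n > 0 the roles are exchanged and the indices already match.
  rcases lt_or_gt_of_ne hn with hn | hn
  · obtain ⟨m, rfl⟩ : ∃ m : ℕ, n = -m := ⟨(-n).toNat, by omega⟩
    have hm : m ≠ 0 := by omega
    have hshift : vertexCoeff α (k + -m) v =
        ∑ᶠ q : ℤ, EMinusInt α (q - k) (EPlusInt α (q - m) v) := by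
      rw [vertexCoeff_apply, ← finsum_comp_equiv (Equiv.subRight (m : ℤ))]
      · refine finsum_congr fun q => ?_
        rw [Equiv.subRight_apply]
        congr 2
        ring
    have hfin : (Function.support fun q : ℤ =>
        (α : ℂ) • EMinusInt α (q - k) (EPlusInt α (q - m) v)).Finite := by
      refine ((vertexSummand_finite α (k - m) v).preimage
        ((Equiv.subRight (m : ℤ)).injective.injOn)).subset fun q hq h => hq ?_
      change (α : ℂ) • EMinusInt α (q - k) (EPlusInt α (q - m) v) = 0
      have h' : EMinusInt α (q - m - (k - m)) (EPlusInt α (q - m) v) = 0 := h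
      rw [sub_sub_sub_cancel_right] at h'
      rw [h', smul_zero]
    rw [hmap, hshift, vertexCoeff_apply, smul_finsum,
      ← finsum_add_distrib (vertexSummand_finite α k _) hfin]
    refine finsum_congr fun q => ?_
    rw [current_neg_EMinusInt, current_neg_EPlusInt α m hm, map_add, map_smul]
  · lift n to ℕ using hn.le
    rw [hmap, vertexCoeff_apply, vertexCoeff_apply, smul_finsum, ← finsum_add_distrib
      (vertexSummand_finite α k _) ((vertexSummand_finite α (k + n) v).subset fun q hq h => hq ?_)]
    · refine finsum_congr fun q => ?_
      rw [current_pos_EMinusInt α n (by omega), current_pos_EPlusInt, sub_sub]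
    · change (α : ℂ) • EMinusInt α (q - (k + n)) (EPlusInt α q v) = 0
      have h' : EMinusInt α (q - (k + n)) (EPlusInt α q v) = 0 := h
      rw [h', smul_zero]

theorem vertexCoeff_current (α β : ℝ) (n k : ℤ) (v : Fock) :
    vertexCoeff α k (current β n v) =
      current (β + α) n (vertexCoeff α k v) - (α : ℂ) • vertexCoeff α (k + n) v := by
  rw [current_vertexCoeff, add_sub_cancel_right]

theorem current_vertexCoeff_zero (α : ℝ) {n : ℤ} (hn : n ≠ 0) (k : ℤ) (v : Fock) :
    current 0 n (vertexCoeff α k v) =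
      vertexCoeff α k (current 0 n v) + (α : ℂ) • vertexCoeff α (k + n) v := by
  rw [← current_vertexCoeff α 0, current_congr 0 (0 + α) hn]

theorem one_mem_levelLT : (1 : Fock) ∈ levelLT 1 := by
  intro a ha
  rw [MvPolynomial.coeff_one] at ha
  have : a = 0 := by
    by_contra h
    exact ha (if_neg (fun h' => h h'.symm))
  simp [this]

theorem vertexCoeff_one (α : ℝ) (k : ℤ) : vertexCoeff α k 1 = EMinusInt α (-k) 1 := by
  rw [vertexCoeff_apply, finsum_eq_single _ 0 fun q hq => ?_]
  · rw [zero_sub]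
    simp [EPlusInt, EPlus, expCoeff_zero]
  · by_cases h : 0 ≤ q
    · rw [EPlusInt_eq_zero α (N := 1) (by omega) one_mem_levelLT, map_zero]
    · simp [EPlusInt, h]

/-- The equation z dE⁻/dz = (∑ α J_{-n} zⁿ) E⁻ on the vacuum. It determines the vectors E⁻_j Ω
through current modes alone. -/
theorem EMinusInt_recursion (α : ℝ) (j : ℕ) :
    (j : ℂ) • EMinusInt α j 1 =
      ∑ r ∈ Finset.range j, (α : ℂ) • current 0 (-(r + 1 : ℕ)) (EMinusInt α (j - (r + 1 : ℕ)) 1) := by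
  have hcomm : Commute (exponent α (-1))
      (PowerSeries.mk (fun r => r • PowerSeries.coeff r (exponent α (-1)))) := by
    ext1 k
    rw [PowerSeries.coeff_mul, PowerSeries.coeff_mul, ← Finset.Nat.sum_antidiagonal_swap]
    refine Finset.sum_congr rfl fun p _ => ?_
    simp only [PowerSeries.coeff_mk, Prod.fst_swap, Prod.snd_swap, mul_smul_comm, smul_mul_assoc]
    congr 1
    by_cases h : p.2 = 0
    · rw [h, coeff_zero_exponent, mul_zero, zero_mul]
    · have := exponent_commutator_same α (-1) (by norm_num) p.2 p.1
      rw [coeff_exponent _ _ h, smul_mul_assoc, mul_smul_comm, sub_eq_zero.1 this]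
  have h := expCoeff_recursion (coeff_zero_exponent α (-1)) hcomm j
  rw [Finset.Nat.sum_antidiagonal_eq_sum_range_succ_mk, Finset.sum_range_succ'] at h
  have h' := congrArg (fun T : Module.End ℂ Fock => T 1) h
  simp only [zero_smul, zero_mul, add_zero, LinearMap.smul_apply, LinearMap.sum_apply] at h'
  have e1 : EMinusInt α j = expCoeff (exponent α (-1)) j := by
    rw [EMinusInt, if_pos (by omega), Int.toNat_natCast]
    rfl
  rw [e1, Nat.cast_smul_eq_nsmul, h']
  refine Finset.sum_congr rfl fun r hr => ?_
  rw [Finset.mem_range] at hr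
  have e2 : EMinusInt α (j - (r + 1 : ℕ)) = expCoeff (exponent α (-1)) (j - (r + 1)) := by
    rw [EMinusInt, if_pos (by omega), EMinus]
    congr 1
    omega
  rw [e2, coeff_exponent _ _ (Nat.succ_ne_zero r), Module.End.mul_apply, LinearMap.smul_apply,
    LinearMap.smul_apply, ← Nat.cast_smul_eq_nsmul ℂ, smul_smul, neg_one_mul]
  congr 1
  have : ((r + 1 : ℕ) : ℂ) ≠ 0 := by exact_mod_cast Nat.succ_ne_zero r
  field_simp

/-- The coefficients of the formal power series `(1 - x) ^ (-t)`. -/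
def binomCoeff (t : ℝ) : ℕ → ℝ
  | 0 => 1
  | n + 1 => (n + t) / (n + 1) * binomCoeff t n

/-- For f = (1 - x)^{-t} one has x f' = t x (1 - x)^{-1} f; this is the same type of recursion as
for E⁻ on the vacuum. -/
theorem sum_binomCoeff (t : ℝ) (n : ℕ) :
    ∑ r ∈ Finset.range n, t * binomCoeff t r = n * binomCoeff t n := by
  induction n with
  | zero => simp
  | succ n ih =>
    rw [Finset.sum_range_succ, ih, binomCoeff]
    push_cast
    field_simp

/-- The coefficients of the formal power series `(1 - x) ^ (-t)`, extended by zero. -/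
def binomCoeffInt (t : ℝ) (k : ℤ) : ℝ := if 0 ≤ k then binomCoeff t k.toNat else 0

/-- The vacuum two-point function is (1 - x)^{-ab}. Expanding the left vector by its recursion and
moving J_{-r-1} to the right lowers the degree of the right vector by r + 1 with a factor b, which
leaves the recursion of `sum_binomCoeff` with t = ab. -/
theorem inner_EMinusInt_nat (a b : ℝ) (i : ℕ) (j : ℤ) :
    ⟪EMinusInt a i 1, EMinusInt b j 1⟫_ℂ = if (i : ℤ) = j then (binomCoeff (a * b) i : ℂ) else 0 := by
  induction i using Nat.strong_induction_on generalizing j with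
  | _ i ih =>
  have h0 : EMinusInt a 0 1 = 1 := by simp [EMinusInt, EMinus, expCoeff_zero]
  have h0' : EMinusInt b 0 1 = 1 := by simp [EMinusInt, EMinus, expCoeff_zero]
  rcases Nat.eq_zero_or_pos i with rfl | hi
  · rw [Nat.cast_zero, h0]
    rcases lt_trichotomy j 0 with hj | rfl | hj
    · rw [if_neg (by omega), EMinusInt, if_neg (by omega)]
      simp
    · rw [h0', inner_one_one]
      simp [binomCoeff]
    · rw [if_neg (by omega)]
      lift j to ℕ using hj.le
      have hj' : (j : ℂ) ≠ 0 := by exact_mod_cast hj.ne'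
      have : (j : ℂ) * ⟪(1 : Fock), EMinusInt b j 1⟫_ℂ = 0 := by
        rw [← inner_smul_right, EMinusInt_recursion, inner_sum]
        refine Finset.sum_eq_zero fun r _ => ?_
        rw [inner_smul_right, inner_current_right, neg_neg, current_one_of_pos 0 (by omega)]
        simp
      exact (mul_eq_zero.1 this).resolve_left hj'
  · have hi' : (i : ℂ) ≠ 0 := by exact_mod_cast hi.ne'
    have : (i : ℂ) * ⟪EMinusInt a i 1, EMinusInt b j 1⟫_ℂ =
        (i : ℂ) * if (i : ℤ) = j then (binomCoeff (a * b) i : ℂ) else 0 := by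
      have e : (i : ℂ) * ⟪EMinusInt a i 1, EMinusInt b j 1⟫_ℂ =
          ⟪(i : ℂ) • EMinusInt a i 1, EMinusInt b j 1⟫_ℂ := by
        rw [inner_smul_left]
        simp
      rw [e, EMinusInt_recursion, sum_inner]
      have hterm : ∀ r ∈ Finset.range i,
          ⟪(a : ℂ) • current 0 (-(r + 1 : ℕ)) (EMinusInt a (i - (r + 1 : ℕ)) 1), EMinusInt b j 1⟫_ℂ =
          if (i : ℤ) = j then ((a * b * binomCoeff (a * b) (i - 1 - r) : ℝ) : ℂ) else 0 := by
        intro r hr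
        rw [Finset.mem_range] at hr
        rw [inner_smul_left, inner_current_left, neg_neg,
          current_pos_EMinusInt b (r + 1) (Nat.succ_ne_zero r),
          current_one_of_pos 0 (by omega), map_zero, zero_add, inner_smul_right,
          show ((i : ℤ) - (r + 1 : ℕ)) = ((i - 1 - r : ℕ) : ℤ) by omega, ih _ (by omega)]
        by_cases h : (i : ℤ) = j
        · rw [if_pos h, if_pos (by omega)]
          push_cast
          rw [Complex.conj_ofReal]
          ring
        · rw [if_neg h, if_neg (by omega), mul_zero, mul_zero]
      rw [Finset.sum_congr rfl hterm]
      split_ifs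
      · rw [← Complex.ofReal_sum, Finset.sum_range_reflect (fun r => a * b * binomCoeff (a * b) r),
          sum_binomCoeff]
        push_cast
        rfl
      · simp
    exact mul_left_cancel₀ hi' this

theorem inner_EMinusInt (a b : ℝ) (i j : ℤ) :
    ⟪EMinusInt a i 1, EMinusInt b j 1⟫_ℂ = if i = j then (binomCoeffInt (a * b) i : ℂ) else 0 := by
  by_cases hi : 0 ≤ i
  · lift i to ℕ using hi
    rw [inner_EMinusInt_nat, binomCoeffInt, if_pos (Int.natCast_nonneg i), Int.toNat_natCast]
  · rw [EMinusInt, binomCoeffInt, if_neg hi, if_neg hi]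
    simp

theorem inner_one_EMinusInt (a : ℝ) (j : ℤ) :
    ⟪(1 : Fock), EMinusInt a j 1⟫_ℂ = if j = 0 then 1 else 0 := by
  have := inner_EMinusInt a a 0 j
  have h0 : EMinusInt a 0 1 = 1 := by simp [EMinusInt, EMinus, expCoeff_zero]
  rw [h0] at this
  rw [this]
  simp only [eq_comm]
  simp [binomCoeffInt, binomCoeff]

/-- `Y_α(z)* = Y_{-α}(1 / z̄)` -/
theorem inner_vertexCoeff_right (α : ℝ) (k : ℤ) (v w : Fock) :
    ⟪v, vertexCoeff α k w⟫_ℂ = ⟪vertexCoeff (-α) (-k) v, w⟫_ℂ := by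
  induction v, w using pair_induction generalizing k with
  | one =>
    rw [vertexCoeff_one, vertexCoeff_one, neg_neg, inner_one_EMinusInt, ← inner_conj_symm,
      inner_one_EMinusInt]
    simp only [neg_eq_zero]
    split_ifs <;> simp
  | add_left v₁ v₂ w h₁ h₂ => rw [inner_add_left, h₁, h₂, map_add, inner_add_left]
  | add_right v w₁ w₂ h₁ h₂ => rw [map_add, inner_add_right, h₁, h₂, inner_add_right]
  | smul_left c v w h => rw [inner_smul_left, h, map_smul, inner_smul_left]
  | smul_right c v w h => rw [map_smul, inner_smul_right, h, inner_smul_right]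
  -- Under adjunction both the charge and the mode index change sign, so the commutators with J_n
  -- and J_{-n} produce the same extra terms on the two sides.
  | current_right n v w hn h₁ h₂ =>
    have e1 := current_vertexCoeff_zero α hn.ne k w
    have e2 := current_vertexCoeff_zero (-α) (neg_ne_zero.2 hn.ne) (-k) v
    rw [← sub_eq_iff_eq_add] at e1
    rw [← e1, inner_sub_right, inner_current_right, h₂, inner_current_right, e2, inner_smul_right,
      h₁, inner_add_left, inner_smul_left, show -(k + n) = -k + -n by ring]
    simp [sub_eq_add_neg]
  | current_left n v hn h =>
    have e1 := current_vertexCoeff_zero α (neg_ne_zero.2 hn.ne) k 1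
    have e2 := current_vertexCoeff_zero (-α) hn.ne (-k) v
    rw [← sub_eq_iff_eq_add] at e2
    rw [inner_current_left, e1, ← e2, inner_sub_left, inner_current_left, inner_add_right,
      current_one_of_pos 0 (by omega), map_zero, inner_zero_right, inner_zero_right,
      inner_smul_left, inner_smul_right, h, show -(k + -n) = -k + n by ring]
    simp

theorem inner_vertexCoeff_left (α : ℝ) (k : ℤ) (v w : Fock) :
    ⟪vertexCoeff α k v, w⟫_ℂ = ⟪v, vertexCoeff (-α) (-k) w⟫_ℂ := by
  rw [inner_vertexCoeff_right, neg_neg, neg_neg]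

/-- For large k the mode annihilates w, and for large -k its adjoint annihilates v: matrix elements
of a single field are Laurent polynomials. -/
theorem inner_vertexCoeff_finite (α : ℝ) (v w : Fock) :
    (Function.support fun k : ℤ => ⟪v, vertexCoeff α k w⟫_ℂ).Finite := by
  obtain ⟨M, hM⟩ := exists_mem_levelLT v
  obtain ⟨N, hN⟩ := exists_mem_levelLT w
  refine (Set.finite_Icc (-(M : ℤ)) N).subset fun k hk => ?_
  by_contra hk'
  apply hk
  rw [Set.mem_Icc, not_and_or, not_le, not_le] at hk'
  change ⟪v, vertexCoeff α k w⟫_ℂ = 0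
  rcases hk' with h | h
  · rw [inner_vertexCoeff_right, vertexCoeff_eq_zero _ (by omega) hM, inner_zero_left]
  · rw [vertexCoeff_eq_zero _ h.le hN, inner_zero_right]

/-- A family of operators with the commutation relations of the modes of a charged field and with
vanishing vacuum expectation values vanishes. -/
theorem eq_zero_of_current_commutator (α : ℝ) (B : ℤ → Module.End ℂ Fock)
    (hB : ∀ n k v, n ≠ 0 → current 0 n (B k v) = B k (current 0 n v) + (α : ℂ) • B (k + n) v)
    (h1 : ∀ k, ⟪(1 : Fock), B k 1⟫_ℂ = 0) (k : ℤ) : B k = 0 := by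
  refine LinearMap.ext fun w => ?_
  rw [LinearMap.zero_apply]
  refine ext_inner_left ℂ fun v => ?_
  rw [inner_zero_right]
  induction v, w using pair_induction generalizing k with
  | one => exact h1 k
  | add_left v₁ v₂ w h₁ h₂ => rw [inner_add_left, h₁, h₂, add_zero]
  | add_right v w₁ w₂ h₁ h₂ => rw [map_add, inner_add_right, h₁, h₂, add_zero]
  | smul_left c v w h => rw [inner_smul_left, h, mul_zero]
  | smul_right c v w h => rw [map_smul, inner_smul_right, h, mul_zero]
  | current_right n v w hn h₁ h₂ =>
    have e1 := hB n k w hn.ne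
    rw [← sub_eq_iff_eq_add] at e1
    rw [← e1, inner_sub_right, inner_current_right, h₂, inner_smul_right, h₁, mul_zero, sub_zero]
  | current_left n v hn h =>
    rw [inner_current_left, hB _ k 1 (neg_ne_zero.2 hn.ne), current_one_of_pos 0 (by omega),
      map_zero, zero_add, inner_smul_right, h, mul_zero]

/-! ### The Sugawara operators -/

theorem sugawara_apply (β : ℝ) (n : ℤ) (v : Fock) :
    sugawara β n v = (1 / 2 : ℂ) • ∑ᶠ k : ℤ, normalOrdered β (n - k) k v := rfl

theorem current_current (β : ℝ) (m n : ℤ) (v : Fock) :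
    current β m (current β n v) =
      current β n (current β m v) + if m + n = 0 then (m : ℂ) • v else 0 := by
  rw [← current_commutator β, add_sub_cancel]

/-- The two orders of J_a and J_b differ by a scalar, so they have the same commutator with J_n. -/
theorem normalOrdered_current (β : ℝ) (a b n : ℤ) (v : Fock) :
    normalOrdered β a b (current β n v) = current β n (normalOrdered β a b v) +
      ((if b + n = 0 then (b : ℂ) • current β a v else 0) +
        if a + n = 0 then (a : ℂ) • current β b v else 0) := by
  have key : ∀ a b : ℤ, current β a (current β b (current β n v)) =
      current β n (current β a (current β b v)) +
      ((if b + n = 0 then (b : ℂ) • current β a v else 0) +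
        if a + n = 0 then (a : ℂ) • current β b v else 0) := fun a b => by
    rw [current_current β b n, map_add, current_current β a n]
    split_ifs <;> simp only [map_smul, map_zero, add_zero, zero_add]
    abel
  unfold normalOrdered
  split_ifs with h
  all_goals
    rw [Module.End.mul_apply, Module.End.mul_apply, key]
    simp_all [add_comm]

/-- `[L_m, J_n] = -n J_{m+n}` -/
theorem sugawara_current (β : ℝ) (m n : ℤ) (v : Fock) :
    sugawara β m (current β n v) =
      current β n (sugawara β m v) - (n : ℂ) • current β (m + n) v := by
  -- Only k = -n and k = m + n give commutator terms. Both are -n J_{m+n}, which the factor 1/2 of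
  -- the Sugawara formula compensates.
  have h1 : ∑ᶠ k : ℤ, normalOrdered β (m - k) k (current β n v) =
      ∑ᶠ k : ℤ, (current β n (normalOrdered β (m - k) k v) +
        ((if k = -n then -(n : ℂ) • current β (m + n) v else 0) +
          if k = m + n then -(n : ℂ) • current β (m + n) v else 0)) := by
    refine finsum_congr fun k => ?_
    rw [normalOrdered_current]
    congr 2
    · by_cases h : k = -n
      · subst h
        rw [if_pos (by ring), if_pos rfl]
        simp
      · rw [if_neg h, if_neg (by omega)]
    · by_cases h : k = m + n
      · subst h
        rw [if_pos (by ring), if_pos rfl]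
        simp
      · rw [if_neg h, if_neg (by omega)]
  have hs : ∀ (c : ℤ) (w : Fock), (Function.support fun k : ℤ => if k = c then w else 0).Finite :=
    fun c w => (Set.finite_singleton c).subset fun k hk => by
      by_contra h
      exact hk (if_neg h)
  have hf : ∀ (c : ℤ) (w : Fock), (∑ᶠ k : ℤ, if k = c then w else 0) = w := fun c w => by
    rw [finsum_eq_single _ c fun k hk => if_neg hk, if_pos rfl]
  have hJ : (Function.support fun k : ℤ => current β n (normalOrdered β (m - k) k v)).Finite :=
    (normalOrdered_locallyFinite β m v).subset fun k hk h => hk (by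
      change current β n (normalOrdered β (m - k) k v) = 0
      have h' : normalOrdered β (m - k) k v = 0 := h
      rw [h', map_zero])
  have h2 : current β n (∑ᶠ k : ℤ, normalOrdered β (m - k) k v) =
      ∑ᶠ k : ℤ, current β n (normalOrdered β (m - k) k v) :=
    (current β n).toAddMonoidHom.map_finsum (normalOrdered_locallyFinite β m v)
  rw [sugawara_apply, sugawara_apply, h1, finsum_add_distrib hJ, finsum_add_distrib (hs _ _) (hs _ _),
    hf, hf, map_smul, h2]
  · module
  · exact ((hs _ _).union (hs _ _)).subset (Function.support_add _ _)

theorem inner_normalOrdered_right (β : ℝ) (a b : ℤ) (v w : Fock) :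
    ⟪v, normalOrdered β a b w⟫_ℂ = ⟪normalOrdered β (-b) (-a) v, w⟫_ℂ := by
  unfold normalOrdered
  by_cases h : a ≤ b
  · rw [if_pos h, if_pos (by omega)]
    simp only [Module.End.mul_apply, inner_current_right]
  · rw [if_neg h, if_neg (by omega)]
    simp only [Module.End.mul_apply, inner_current_right]

/-- `L_m* = L_{-m}` -/
theorem inner_sugawara_right (β : ℝ) (m : ℤ) (v w : Fock) :
    ⟪v, sugawara β m w⟫_ℂ = ⟪sugawara β (-m) v, w⟫_ℂ := by
  have h1 : ⟪v, ∑ᶠ k : ℤ, normalOrdered β (m - k) k w⟫_ℂ =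
      ∑ᶠ k : ℤ, ⟪v, normalOrdered β (m - k) k w⟫_ℂ :=
    (innerₛₗ ℂ v).toAddMonoidHom.map_finsum (normalOrdered_locallyFinite β m w)
  have h2 : ⟪∑ᶠ k : ℤ, normalOrdered β (-m - k) k v, w⟫_ℂ =
      ∑ᶠ k : ℤ, ⟪normalOrdered β (-m - k) k v, w⟫_ℂ :=
    ((innerₛₗ ℂ).flip w).toAddMonoidHom.map_finsum (normalOrdered_locallyFinite β (-m) v)
  rw [sugawara_apply, sugawara_apply, inner_smul_right, inner_smul_left, h1, h2,
    ← finsum_comp_equiv (Equiv.subRight m) (f := fun k => ⟪normalOrdered β (-m - k) k v, w⟫_ℂ)]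
  congr 1
  · simp [map_ofNat]
  · refine finsum_congr fun k => ?_
    rw [inner_normalOrdered_right, Equiv.subRight_apply, neg_sub, sub_sub_eq_add_sub,
      neg_add_eq_sub, sub_self, zero_sub]

theorem inner_sugawara_left (β : ℝ) (m : ℤ) (v w : Fock) :
    ⟪sugawara β m v, w⟫_ℂ = ⟪v, sugawara β (-m) w⟫_ℂ := by
  rw [inner_sugawara_right, neg_neg]

/-! ### Reality and oddness of the central term. -/

theorem inner_one_left (v : Fock) : ⟪(1 : Fock), v⟫_ℂ = MvPolynomial.coeff 0 v := by
  have : (1 : Fock).support ⊆ {0} := fun a ha => by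
    rw [MvPolynomial.mem_support_iff, MvPolynomial.coeff_one] at ha
    rw [Finset.mem_singleton]
    by_contra h
    exact ha (if_neg fun h' => h h'.symm)
  rw [Fock.inner_eq, Fock.form_eq _ _ _ this]
  simp [Fock.weight]

/-- The charge and all structure constants are real, so conjugation of the coefficients commutes
with the modes; this serves to show that the central term is real. -/
theorem map_conj_current (β : ℝ) (n : ℤ) (v : Fock) :
    MvPolynomial.map (starRingEnd ℂ) (current β n v) =
      current β n (MvPolynomial.map (starRingEnd ℂ) v) := by
  rcases int_cases_pnat n with rfl | ⟨p, rfl⟩ | ⟨p, rfl⟩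
  · simp [current_zero, MvPolynomial.smul_eq_C_mul]
  · simp [current_pos, MvPolynomial.smul_eq_C_mul, MvPolynomial.pderiv_map]
  · simp [current_neg]

theorem map_conj_sugawara (β : ℝ) (n : ℤ) (v : Fock) :
    MvPolynomial.map (starRingEnd ℂ) (sugawara β n v) =
      sugawara β n (MvPolynomial.map (starRingEnd ℂ) v) := by
  have h1 : MvPolynomial.map (starRingEnd ℂ) (∑ᶠ k : ℤ, normalOrdered β (n - k) k v) =
      ∑ᶠ k : ℤ, MvPolynomial.map (starRingEnd ℂ) (normalOrdered β (n - k) k v) :=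
    (MvPolynomial.map (starRingEnd ℂ)).toAddMonoidHom.map_finsum (normalOrdered_locallyFinite β n v)
  rw [sugawara_apply, sugawara_apply, MvPolynomial.smul_eq_C_mul, map_mul, h1, MvPolynomial.map_C,
    ← MvPolynomial.smul_eq_C_mul]
  congr 1
  · simp [map_ofNat]
  · refine finsum_congr fun k => ?_
    unfold normalOrdered
    split_ifs <;> simp only [Module.End.mul_apply, map_conj_current]

/-- The deviation of the Sugawara operators from the Witt relations. -/
def sugawaraDefect (β : ℝ) (m n : ℤ) : Module.End ℂ Fock :=
  sugawara β m * sugawara β n - sugawara β n * sugawara β m - ((m : ℂ) - n) • sugawara β (m + n)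

theorem sugawaraDefect_apply (β : ℝ) (m n : ℤ) (v : Fock) :
    sugawaraDefect β m n v = sugawara β m (sugawara β n v) - sugawara β n (sugawara β m v) -
      ((m : ℂ) - n) • sugawara β (m + n) v := rfl

/-- The central term in the commutator of two Sugawara operators. -/
def centralTerm (β : ℝ) (m n : ℤ) : ℂ := ⟪(1 : Fock), sugawaraDefect β m n 1⟫_ℂ

/-- The defect commutes with every J_n, n ≠ 0, by the Jacobi identity, hence is a scalar by
irreducibility. This is `eq_zero_of_current_commutator` for charge 0 and a constant family. -/
theorem sugawaraDefect_eq (β : ℝ) (m n : ℤ) (v : Fock) :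
    sugawaraDefect β m n v = centralTerm β m n • v := by
  have h := eq_zero_of_current_commutator 0
    (fun _ => sugawaraDefect β m n - centralTerm β m n • 1) (fun p _ v hp => ?_) (fun _ => ?_) 0
  · have := congrArg (fun T : Module.End ℂ Fock => T v) h
    simpa [sub_eq_zero] using this
  · simp only [LinearMap.sub_apply, LinearMap.smul_apply, Module.End.one_apply,
      sugawaraDefect_apply, current_congr 0 β hp, map_sub, map_smul, sugawara_current]
    rw [show n + (m + p) = m + n + p by ring, show m + (n + p) = m + n + p by ring]
    push_cast
    module
  · rw [LinearMap.sub_apply, inner_sub_right, LinearMap.smul_apply, inner_smul_right,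
      Module.End.one_apply, inner_one_one, mul_one]
    exact sub_self _

theorem centralTerm_conj (β : ℝ) (m n : ℤ) :
    starRingEnd ℂ (centralTerm β m n) = centralTerm β m n := by
  have h : MvPolynomial.map (starRingEnd ℂ) (sugawaraDefect β m n 1) = sugawaraDefect β m n 1 := by
    simp only [sugawaraDefect_apply, map_sub, MvPolynomial.smul_eq_C_mul, map_mul,
      map_conj_sugawara, map_one, map_intCast]
  unfold centralTerm
  rw [inner_one_left, ← MvPolynomial.coeff_map, h]

/-- Adjunction sends L_m to L_{-m} and reverses commutators, so it maps the central term to minus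
its value at (-m, -n); the conjugate it introduces is harmless by `centralTerm_conj`. -/
theorem centralTerm_neg (β : ℝ) (m n : ℤ) : centralTerm β (-m) (-n) = -centralTerm β m n := by
  rw [← centralTerm_conj β m n]
  unfold centralTerm
  simp only [sugawaraDefect_apply, inner_sub_right, inner_smul_right, inner_sugawara_right, neg_neg,
    map_sub, map_mul, inner_conj_symm, ← neg_add]
  rw [inner_sugawara_left, inner_sugawara_left, inner_sugawara_left]
  rw [inner_sugawara_right, inner_sugawara_right]
  simp
  ring

/-- `[L_m, L_n] = (m - n) L_{m+n}` up to a central term. -/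
theorem sugawara_commutator (β : ℝ) (m n : ℤ) (v : Fock) :
    sugawara β m (sugawara β n v) - sugawara β n (sugawara β m v) =
      ((m : ℂ) - n) • sugawara β (m + n) v + centralTerm β m n • v := by
  rw [← sugawaraDefect_eq, sugawaraDefect_apply, add_sub_cancel]

/-! ### The charged fields are primary -/

theorem sugawara_one (β : ℝ) {m : ℤ} (hm : 0 ≤ m) :
    sugawara β m 1 = (if m = 0 then (β : ℂ) ^ 2 / 2 else 0) • 1 := by
  rw [sugawara_apply, finsum_eq_single _ 0 fun i hi => ?_]
  · unfold normalOrdered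
    rw [sub_zero]
    by_cases h : m = 0
    · subst h
      rw [if_pos le_rfl, if_pos rfl, Module.End.mul_apply, current_zero, current_zero, smul_smul,
        smul_smul]
      congr 1
      ring
    · rw [if_neg (by omega), if_neg h, Module.End.mul_apply, current_one_of_pos β (by omega)]
      simp
  · unfold normalOrdered
    split_ifs with h
    · rw [Module.End.mul_apply, current_one_of_pos β (by omega), map_zero]
    · rw [Module.End.mul_apply, current_one_of_pos β (by omega), map_zero]

/-- E⁻(α, z) Ω is a coherent state, an eigenvector of all lowering modes; the charge β enters only
through J_0. -/
theorem current_EMinusInt_one (α β : ℝ) {p : ℤ} (hp : 0 ≤ p) (j : ℤ) :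
    current (β + α) p (EMinusInt α j 1) =
      ((α : ℂ) + if p = 0 then (β : ℂ) else 0) • EMinusInt α (j - p) 1 := by
  by_cases h : p = 0
  · subst h
    rw [current_zero, if_pos rfl, sub_zero]
    push_cast
    rw [add_comm]
  · lift p to ℕ using hp
    rw [current_congr _ 0 h, current_pos_EMinusInt α p (by omega), current_one_of_pos 0 (by omega),
      map_zero, zero_add, if_neg h, add_zero]

theorem inner_one_sugawara_EMinusInt (α β : ℝ) (m : ℕ) (j : ℤ) :
    ⟪(1 : Fock), sugawara (β + α) m (EMinusInt α j 1)⟫_ℂ =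
      if j = m then (m + 1) * ((α : ℂ) ^ 2 / 2) + α * β + if m = 0 then (β : ℂ) ^ 2 / 2 else 0 else 0 := by
  have h1 : ⟪(1 : Fock), ∑ᶠ i : ℤ, normalOrdered (β + α) (m - i) i (EMinusInt α j 1)⟫_ℂ =
      ∑ᶠ i : ℤ, ⟪(1 : Fock), normalOrdered (β + α) (m - i) i (EMinusInt α j 1)⟫_ℂ :=
    (innerₛₗ ℂ (1 : Fock)).toAddMonoidHom.map_finsum (normalOrdered_locallyFinite _ _ _)
  -- For i < 0 or i > m the smaller index is negative and stands on the left, where its adjoint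
  -- annihilates the vacuum. The remaining m + 1 terms act on a coherent state.
  have h2 : ∀ i : ℤ, ⟪(1 : Fock), normalOrdered (β + α) (m - i) i (EMinusInt α j 1)⟫_ℂ =
      if 0 ≤ i ∧ i ≤ m then (if j = m then
        ((α : ℂ) + if i = 0 then (β : ℂ) else 0) * (α + if i = m then (β : ℂ) else 0) else 0)
      else 0 := by
    intro i
    by_cases hi : 0 ≤ i ∧ i ≤ (m : ℤ)
    · rw [if_pos hi]
      have e : ∀ a b : ℤ, 0 ≤ a → 0 ≤ b → a + b = m →
          ⟪(1 : Fock), current (β + α) a (current (β + α) b (EMinusInt α j 1))⟫_ℂ =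
          if j = m then ((α : ℂ) + if a = 0 then (β : ℂ) else 0) * (α + if b = 0 then (β : ℂ) else 0)
          else 0 := fun a b ha hb hab => by
        rw [current_EMinusInt_one α β hb, map_smul, current_EMinusInt_one α β ha, inner_smul_right,
          inner_smul_right, inner_one_EMinusInt]
        by_cases hj : j = m
        · rw [if_pos hj, if_pos (show j - b - a = 0 by omega)]
          ring
        · rw [if_neg hj, if_neg (show ¬ j - b - a = 0 by omega)]
          ring
      have e0 : (m - i = 0) = (i = m) := by
        rw [eq_iff_iff]
        omega
      unfold normalOrdered
      by_cases hc : m - i ≤ i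
      · rw [if_pos hc, Module.End.mul_apply, e _ _ (by omega) (by omega) (by ring)]
        simp only [e0]
        rw [mul_comm (_ + _)]
      · rw [if_neg hc, Module.End.mul_apply, e _ _ (by omega) (by omega) (by ring)]
        simp only [e0]
    · rw [if_neg hi]
      unfold normalOrdered
      split_ifs
      · rw [Module.End.mul_apply, inner_current_right, current_one_of_pos _ (by omega),
          inner_zero_left]
      · rw [Module.End.mul_apply, inner_current_right, current_one_of_pos _ (by omega),
          inner_zero_left]
  rw [sugawara_apply, inner_smul_right, h1, finsum_congr h2]
  have h3 : (∑ᶠ i : ℤ, if 0 ≤ i ∧ i ≤ (m : ℤ) then (if j = m then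
        ((α : ℂ) + if i = 0 then (β : ℂ) else 0) * (α + if i = m then (β : ℂ) else 0) else 0)
      else 0) = ∑ i ∈ Finset.Icc (0 : ℤ) m, (if j = m then
        ((α : ℂ) + if i = 0 then (β : ℂ) else 0) * (α + if i = m then (β : ℂ) else 0) else 0) := by
    rw [finsum_eq_sum_of_support_subset (s := Finset.Icc (0 : ℤ) m)]
    · refine Finset.sum_congr rfl fun i hi => ?_
      rw [if_pos (Finset.mem_Icc.1 hi)]
    · intro i hi
      rw [Finset.mem_coe, Finset.mem_Icc]
      by_contra h
      exact hi (if_neg h)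
  rw [h3]
  by_cases hj : j = m
  swap
  · simp [hj]
  by_cases hm : m = 0
  · subst hm
    simp [hj]
    ring
  · simp only [hj, hm, if_true, if_false, add_mul, mul_add, Finset.sum_add_distrib, mul_ite, mul_zero, ite_mul, zero_mul,
      Finset.sum_ite_eq', Finset.mem_Icc, le_refl, Int.natCast_nonneg, and_self, if_true]
    simp [hm]
    ring

/-- `[L_m, Y_{α,s}] = ((d - 1) m - s) Y_{α,m+s}`, where `d = α² / 2` and `s = k - α β - d`. -/
theorem sugawara_vertexCoeff_nat (α β : ℝ) (m : ℕ) (k : ℤ) (v : Fock) :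
    sugawara (β + α) m (vertexCoeff α k v) = vertexCoeff α k (sugawara β m v) +
      (((α : ℂ) ^ 2 / 2 - 1) * m - k + α * β + α ^ 2 / 2) • vertexCoeff α (k + m) v := by
  -- The difference of the two sides has the same commutators with the currents as Y_α itself, so
  -- only its vacuum expectation value remains to be computed.
  have h := eq_zero_of_current_commutator α
    (fun k => sugawara (β + α) m * vertexCoeff α k - vertexCoeff α k * sugawara β m -
      (((α : ℂ) ^ 2 / 2 - 1) * m - k + α * β + α ^ 2 / 2) • vertexCoeff α (k + m))
    (fun n k v hn => ?_) (fun k => ?_) k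
  · have := congrArg (fun T : Module.End ℂ Fock => T v) h
    simp only [LinearMap.sub_apply, Module.End.mul_apply,
      LinearMap.zero_apply, sub_sub, sub_eq_zero] at this
    exact this
  · have e1 : ∀ k w, vertexCoeff α k (current 0 n w) =
        current (β + α) n (vertexCoeff α k w) - (α : ℂ) • vertexCoeff α (k + n) w := fun k w => by
      rw [current_congr 0 β hn, vertexCoeff_current]
    have e2 : sugawara β m (current 0 n v) =
        current 0 n (sugawara β m v) - (n : ℂ) • current β (m + n) v := by
      rw [current_congr 0 β hn, sugawara_current]
    simp only [LinearMap.sub_apply, Module.End.mul_apply, LinearMap.smul_apply, e2, map_sub,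
      map_smul, e1, vertexCoeff_current α β (m + n)]
    simp only [current_congr 0 (β + α) hn, sugawara_current,
      show k + m + n = k + n + m by ring, show k + (m + n) = k + n + m by ring]
    push_cast
    module
  · simp only [LinearMap.sub_apply, Module.End.mul_apply, LinearMap.smul_apply]
    rw [sugawara_one β (Int.natCast_nonneg m), map_smul, inner_sub_right, inner_sub_right,
      inner_smul_right, inner_smul_right, vertexCoeff_one, vertexCoeff_one,
      inner_one_sugawara_EMinusInt, inner_one_EMinusInt, inner_one_EMinusInt]
    by_cases hk : -k = m
    · have hk' : (k : ℂ) = -m := by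
        rw [← neg_eq_iff_eq_neg]
        exact_mod_cast hk
      rw [if_pos hk, if_pos (show -(k + m) = 0 by omega), hk']
      by_cases hm : m = 0
      · subst hm
        rw [if_pos rfl, if_pos (by simp), if_pos (by omega)]
        push_cast
        ring
      · rw [if_neg hm, if_neg (by omega)]
        ring
    · rw [if_neg hk, if_neg (show ¬ -(k + m) = 0 by omega)]
      by_cases hm : m = 0
      · subst hm
        rw [if_neg (show ¬ -k = 0 by simpa using hk)]
        ring
      · rw [if_neg (show ¬ (m : ℤ) = 0 by omega)]
        ring

/-- For m < 0 the vacuum is not in general an eigenvector of L_m. This case is the adjoint of the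
case of positive index, for charge -α on the sector β + α. -/
theorem sugawara_vertexCoeff (α β : ℝ) (m k : ℤ) (v : Fock) :
    sugawara (β + α) m (vertexCoeff α k v) = vertexCoeff α k (sugawara β m v) +
      (((α : ℂ) ^ 2 / 2 - 1) * m - k + α * β + α ^ 2 / 2) • vertexCoeff α (k + m) v := by
  rcases Int.eq_nat_or_neg m with ⟨m, rfl | rfl⟩
  · exact sugawara_vertexCoeff_nat α β m k v
  · refine ext_inner_left ℂ fun w => ?_
    have h := sugawara_vertexCoeff_nat (-α) (β + α) m (-k) w
    rw [add_neg_cancel_right] at h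
    rw [inner_sugawara_right, neg_neg, inner_vertexCoeff_right, inner_add_right,
      inner_vertexCoeff_right, inner_sugawara_right, neg_neg, h, inner_add_left, inner_smul_left,
      inner_smul_right, inner_vertexCoeff_right, show -(k + -(m : ℤ)) = -k + m by ring]
    simp [map_ofNat]
    ring

/-! ### Square summability of binomial coefficients -/

theorem abs_binomCoeff_le (t : ℝ) (n : ℕ) : |binomCoeff t n| ≤ binomCoeff |t| n := by
  induction n with
  | zero => simp [binomCoeff]
  | succ n ih =>
    rw [binomCoeff, binomCoeff, abs_mul, abs_div, abs_of_pos (show (0 : ℝ) < n + 1 by positivity)]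
    have : |(n : ℝ) + t| ≤ n + |t| := (abs_add_le _ _).trans_eq (by simp)
    gcongr

/-- By induction on n: the ratio (n + t)/(n + 1) is compared with ((n + 2)/(n + 1))^{t-1} through
Bernoulli's inequality with exponent 1 - t in [0, 1]. -/
theorem binomCoeff_le_rpow {t : ℝ} (ht : 0 ≤ t) (ht1 : t ≤ 1) (n : ℕ) :
    binomCoeff t n ≤ ((n : ℝ) + 1) ^ (t - 1) := by
  induction n with
  | zero => simp [binomCoeff]
  | succ n ih =>
    have hn : (0 : ℝ) < n + 1 := by positivity
    have h1 : (1 + 1 / ((n : ℝ) + 1)) ^ (1 - t) ≤ 1 + (1 - t) * (1 / (n + 1)) :=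
      rpow_one_add_le_one_add_mul_self
        (by have : 0 ≤ 1 / ((n : ℝ) + 1) := by positivity
            linarith) (by linarith) (by linarith)
    have h2 : ((n : ℝ) + t) / (n + 1) * (1 + 1 / ((n : ℝ) + 1)) ^ (1 - t) ≤ 1 := by
      refine (mul_le_mul_of_nonneg_left h1 (by positivity)).trans ?_
      rw [show ((n : ℝ) + t) / (n + 1) * (1 + (1 - t) * (1 / (n + 1))) =
        ((n + t) * (n + 1 + (1 - t))) / ((n + 1) * (n + 1)) by field_simp]
      rw [div_le_one (by positivity)]
      -- The numerator is (n + 1)² - (1 - t)².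
      nlinarith [sq_nonneg (1 - t)]
    have h3 : ((n : ℝ) + 1 + 1) ^ (t - 1) =
        ((n : ℝ) + 1) ^ (t - 1) * ((1 + 1 / ((n : ℝ) + 1)) ^ (1 - t))⁻¹ := by
      rw [← Real.rpow_neg (by positivity), neg_sub, ← Real.mul_rpow (by positivity) (by positivity)]
      congr 1
      field_simp
    have h4 : 0 < (1 + 1 / ((n : ℝ) + 1)) ^ (1 - t) := by positivity
    rw [binomCoeff]
    push_cast
    rw [h3, mul_comm]
    refine mul_le_mul ih ?_ (by positivity) (by positivity)
    rw [← one_div, le_div_iff₀ h4]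
    exact h2

/-- The squares are O(n^{2|t| - 2}), and 2|t| - 2 < -1 means |t| < 1/2. The bound on the charge
enters the analysis here. -/
theorem summable_binomCoeffInt_sq {t : ℝ} (ht : |t| < 1 / 2) :
    Summable fun k : ℤ => binomCoeffInt t k ^ 2 := by
  have h1 : Summable fun n : ℕ => binomCoeff t n ^ 2 := by
    have h2 : Summable fun n : ℕ => (((n + 1 : ℕ) : ℝ)) ^ (2 * (|t| - 1)) :=
      (summable_nat_add_iff 1).2 (Real.summable_nat_rpow.2 (by linarith))
    refine Summable.of_nonneg_of_le (fun n => sq_nonneg _) (fun n => ?_) h2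
    have h3 := (abs_binomCoeff_le t n).trans (binomCoeff_le_rpow (abs_nonneg t) (by linarith) n)
    rw [← sq_abs, mul_comm, Real.rpow_mul (by positivity), Real.rpow_two]
    push_cast
    exact pow_le_pow_left₀ (abs_nonneg _) h3 2
  have hinj : Function.Injective (Nat.cast : ℕ → ℤ) := Nat.cast_injective
  refine (hinj.summable_iff fun k hk => ?_).1 (h1.congr fun n => ?_)
  · rw [binomCoeffInt, if_neg fun h => hk ⟨k.toNat, by omega⟩]
    simp
  · simp [binomCoeffInt]

theorem summable_binomCoeffInt_mul {t : ℝ} (ht : |t| < 1 / 2) (e₁ e₂ : ℤ ≃ ℤ) :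
    Summable fun k : ℤ => (binomCoeffInt t (e₁ k) : ℂ) * binomCoeffInt t (e₂ k) := by
  have h1 := e₁.summable_iff.2 (summable_binomCoeffInt_sq ht)
  have h2 := e₂.summable_iff.2 (summable_binomCoeffInt_sq ht)
  refine Summable.of_norm_bounded (h1.add h2) fun k => ?_
  rw [norm_mul, Complex.norm_real, Complex.norm_real, Function.comp_apply, Function.comp_apply,
    ← sq_abs (binomCoeffInt t (e₁ k)), ← sq_abs (binomCoeffInt t (e₂ k)), Real.norm_eq_abs,
    Real.norm_eq_abs]
  nlinarith [sq_nonneg (|binomCoeffInt t (e₁ k)| - |binomCoeffInt t (e₂ k)|),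
    sq_nonneg (|binomCoeffInt t (e₁ k)| + |binomCoeffInt t (e₂ k)|)]

/-- The autocorrelation of the coefficients of `(1 - x) ^ (-t)`. -/
def autocorrelation (t : ℝ) (r : ℤ) : ℂ :=
  ∑' k : ℤ, (binomCoeffInt t k : ℂ) * binomCoeffInt t (k - r)

theorem hasSum_autocorrelation {t : ℝ} (ht : |t| < 1 / 2) (u u' : ℤ) :
    HasSum (fun k : ℤ => (binomCoeffInt t (k - u) : ℂ) * binomCoeffInt t (k - u'))
      (autocorrelation t (u' - u)) := by
  have h := (summable_binomCoeffInt_mul ht (Equiv.refl ℤ) (Equiv.subRight (u' - u))).hasSum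
  rw [← (Equiv.subRight u).hasSum_iff] at h
  rwa [show _ ∘ _ = fun k : ℤ => (binomCoeffInt t (k - u) : ℂ) * binomCoeffInt t (k - u') from
    funext fun k => by simp] at h

/-- This symmetry is what locality reduces to: exchanging the two fields reverses the sign of r. -/
theorem autocorrelation_neg (t : ℝ) (r : ℤ) : autocorrelation t (-r) = autocorrelation t r := by
  unfold autocorrelation
  rw [← (Equiv.subRight r).tsum_eq]
  refine tsum_congr fun k => ?_
  rw [Equiv.subRight_apply, sub_neg_eq_add, sub_add_cancel, mul_comm]

/-! ### Matrix elements of products of two charged fields -/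

/-- The coefficient of `z ^ (-k) w ^ (-q)` in `z ^ (-P.1) w ^ (-P.2) (1 - w / z) ^ (-t)`. -/
def leftKernel (t : ℝ) (k q : ℤ) (P : ℤ × ℤ) : ℂ :=
  if k + q = P.1 + P.2 then (binomCoeffInt t (k - P.1) : ℂ) else 0

/-- The coefficient of `z ^ (-k) w ^ (-q)` in `z ^ (-P.1) w ^ (-P.2) (1 - z / w) ^ (-t)`. -/
def rightKernel (t : ℝ) (k q : ℤ) (P : ℤ × ℤ) : ℂ :=
  if k + q = P.1 + P.2 then (binomCoeffInt t (q - P.2) : ℂ) else 0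

/-- The functions `F` and `G` are the coefficients of the expansions in the regions `|w| < |z|` and
`|z| < |w|` of a Laurent polynomial times `(1 - w / z) ^ (-t)` and `(1 - z / w) ^ (-t)`. -/
def IsExpansion (t : ℝ) (F G : ℤ → ℤ → ℂ) : Prop :=
  ∃ p : ℤ × ℤ →₀ ℂ, (∀ k q, F k q = Finsupp.linearCombination ℂ (leftKernel t k q) p) ∧
    ∀ k q, G k q = Finsupp.linearCombination ℂ (rightKernel t k q) p

theorem IsExpansion.add {t : ℝ} {F G F' G' : ℤ → ℤ → ℂ} (h : IsExpansion t F G)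
    (h' : IsExpansion t F' G') :
    IsExpansion t (fun k q => F k q + F' k q) (fun k q => G k q + G' k q) := by
  obtain ⟨p, hF, hG⟩ := h
  obtain ⟨p', hF', hG'⟩ := h'
  exact ⟨p + p', fun k q => by beta_reduce; rw [hF, hF', map_add], fun k q => by beta_reduce; rw [hG, hG', map_add]⟩

theorem IsExpansion.const_mul {t : ℝ} {F G : ℤ → ℤ → ℂ} (c : ℂ) (h : IsExpansion t F G) :
    IsExpansion t (fun k q => c * F k q) (fun k q => c * G k q) := by
  obtain ⟨p, hF, hG⟩ := h
  exact ⟨c • p, fun k q => by beta_reduce; rw [hF, map_smul, smul_eq_mul],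
    fun k q => by beta_reduce; rw [hG, map_smul, smul_eq_mul]⟩

theorem IsExpansion.shift {t : ℝ} {F G : ℤ → ℤ → ℂ} (r s : ℤ) (h : IsExpansion t F G) :
    IsExpansion t (fun k q => F (k + r) (q + s)) (fun k q => G (k + r) (q + s)) := by
  obtain ⟨p, hF, hG⟩ := h
  have e : ∀ k q (P : ℤ × ℤ), (k + r + (q + s) = P.1 + P.2) = (k + q = P.1 - r + (P.2 - s)) :=
    fun k q P => by
      rw [eq_iff_iff]
      constructor <;> intro h <;> linarith
  refine ⟨p.mapDomain fun P => (P.1 - r, P.2 - s), fun k q => ?_, fun k q => ?_⟩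
  · beta_reduce
    rw [hF, Finsupp.linearCombination_mapDomain]
    congr 2
    funext P
    simp only [leftKernel, Function.comp_apply, e]
    congr 3
    ring
  · beta_reduce
    rw [hG, Finsupp.linearCombination_mapDomain]
    congr 2
    funext P
    simp only [rightKernel, Function.comp_apply, e]
    congr 3
    ring

/-- On the vacuum the Laurent polynomial is 1, by the two-point function. Moving J_n across both
fields gives terms with factors a zⁿ and b wⁿ, irrespective of the order of the fields, so one
polynomial serves both expansions. -/
theorem isExpansion_inner_vertexCoeff (a b : ℝ) (v w : Fock) :
    IsExpansion (-(a * b)) (fun k q => ⟪v, vertexCoeff a k (vertexCoeff b q w)⟫_ℂ)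
      (fun k q => ⟪v, vertexCoeff b q (vertexCoeff a k w)⟫_ℂ) := by
  induction v, w using pair_induction with
  | one =>
    refine ⟨Finsupp.single 0 1, fun k q => ?_, fun k q => ?_⟩
    · beta_reduce
      rw [inner_vertexCoeff_right, vertexCoeff_one, vertexCoeff_one, neg_neg, inner_EMinusInt,
        Finsupp.linearCombination_single, one_smul, leftKernel]
      simp only [Prod.fst_zero, Prod.snd_zero, sub_zero, add_zero, ← eq_neg_iff_add_eq_zero, neg_mul]
    · beta_reduce
      rw [inner_vertexCoeff_right, vertexCoeff_one, vertexCoeff_one, neg_neg, inner_EMinusInt,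
        Finsupp.linearCombination_single, one_smul, rightKernel]
      simp only [Prod.fst_zero, Prod.snd_zero, sub_zero, add_zero, add_comm k q,
        ← eq_neg_iff_add_eq_zero, neg_mul, mul_comm b a]
  | add_left v₁ v₂ w h₁ h₂ => simpa only [inner_add_left] using h₁.add h₂
  | add_right v w₁ w₂ h₁ h₂ => simpa only [map_add, inner_add_right] using h₁.add h₂
  | smul_left c v w h => simpa only [inner_smul_left] using h.const_mul _
  | smul_right c v w h => simpa only [map_smul, inner_smul_right] using h.const_mul c
  | current_right n v w hn h₁ h₂ =>
    have h := h₂.add (((h₁.shift n 0).const_mul (-a)).add ((h₁.shift 0 n).const_mul (-b)))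
    have e : ∀ (c : ℝ) k w, vertexCoeff c k (current 0 n w) =
        current 0 n (vertexCoeff c k w) - (c : ℂ) • vertexCoeff c (k + n) w := fun c k w => by
      rw [current_vertexCoeff_zero c hn.ne, add_sub_cancel_right]
    convert h using 3 with k q k q
    all_goals
      simp only [e, map_sub, map_smul, inner_sub_right, inner_smul_right, inner_current_right,
        add_zero]
      ring
  | current_left n v hn h =>
    have h' := ((h.shift (-n) 0).const_mul a).add ((h.shift 0 (-n)).const_mul b)
    have e : ∀ (c : ℝ) k w, current 0 (-n) (vertexCoeff c k w) =
        vertexCoeff c k (current 0 (-n) w) + (c : ℂ) • vertexCoeff c (k + -n) w := fun c k w =>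
      current_vertexCoeff_zero c (neg_ne_zero.2 hn.ne) k w
    convert h' using 3 with k q k q
    all_goals
      simp only [inner_current_left, e, map_smul, inner_add_right, inner_smul_right,
        add_zero, current_one_of_pos 0 (neg_pos.2 hn), map_zero, zero_add]
    rw [add_comm]

theorem linearCombination_mul_linearCombination {ι κ : Type*} (f : ι → ℂ) (g : κ → ℂ) (p : ι →₀ ℂ)
    (p' : κ →₀ ℂ) : Finsupp.linearCombination ℂ f p * Finsupp.linearCombination ℂ g p' =
      ∑ x ∈ p.support ×ˢ p'.support, p x.1 * p' x.2 * (f x.1 * g x.2) := by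
  rw [Finsupp.linearCombination_apply, Finsupp.linearCombination_apply, Finsupp.sum, Finsupp.sum,
    Finset.sum_mul_sum, Finset.sum_product]
  refine Finset.sum_congr rfl fun i _ => Finset.sum_congr rfl fun j _ => ?_
  simp only [smul_eq_mul]
  ring

/-- The two-dimensional fields commute at time zero, in terms of matrix elements of modes. -/
theorem exists_hasSum_vertexCoeff_comm (a b : ℝ) (hab : |a * b| < 1 / 2) (m n : ℤ)
    (v v' w w' : Fock) : ∃ (R R' : ℤ → ℂ) (T : ℂ),
      (∀ k, HasSum (fun q => ⟪v, vertexCoeff a k (vertexCoeff b q v')⟫_ℂ *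
        ⟪w, vertexCoeff a (k - m) (vertexCoeff b (q - n) w')⟫_ℂ) (R k)) ∧ HasSum R T ∧
      (∀ q, HasSum (fun k => ⟪v, vertexCoeff b q (vertexCoeff a k v')⟫_ℂ *
        ⟪w, vertexCoeff b (q - n) (vertexCoeff a (k - m) w')⟫_ℂ) (R' q)) ∧ HasSum R' T := by
  obtain ⟨p, hF, hG⟩ := isExpansion_inner_vertexCoeff a b v v'
  obtain ⟨p', hF', hG'⟩ := isExpansion_inner_vertexCoeff a b w w'
  beta_reduce at hF hG hF' hG'
  set t := -(a * b) with ht_def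
  have ht : |t| < 1 / 2 := by rwa [ht_def, abs_neg]
  -- Each kernel fixes k + q; the two constraints are compatible exactly under this condition. Then,
  -- for fixed k, a pair of monomials contributes for a single q, and the sum over k is an
  -- autocorrelation.
  let cond : (ℤ × ℤ) × (ℤ × ℤ) → Prop := fun x => x.1.1 + x.1.2 = m + n + (x.2.1 + x.2.2)
  have hcond : ∀ x, Decidable (cond x) := fun x => inferInstanceAs (Decidable (_ = _))
  refine ⟨fun k => ∑ x ∈ p.support ×ˢ p'.support, p x.1 * p' x.2 * if cond x then
      (binomCoeffInt t (k - x.1.1) : ℂ) * binomCoeffInt t (k - (m + x.2.1)) else 0,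
    fun q => ∑ x ∈ p.support ×ˢ p'.support, p x.1 * p' x.2 * if cond x then
      (binomCoeffInt t (q - x.1.2) : ℂ) * binomCoeffInt t (q - (n + x.2.2)) else 0,
    ∑ x ∈ p.support ×ˢ p'.support, p x.1 * p' x.2 * if cond x then
      autocorrelation t (m + x.2.1 - x.1.1) else 0, fun k => ?_, ?_, fun q => ?_, ?_⟩
  · simp only [hF, hF', linearCombination_mul_linearCombination]
    refine hasSum_sum fun x _ => HasSum.mul_left _ ?_
    refine (congrArg (HasSum · _) (funext fun q => ?_)).mp (hasSum_ite_eq (x.1.1 + x.1.2 - k) (if cond x then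
      (binomCoeffInt t (k - x.1.1) : ℂ) * binomCoeffInt t (k - (m + x.2.1)) else 0))
    symm
    unfold leftKernel
    by_cases hq : q = x.1.1 + x.1.2 - k
    · rw [if_pos hq, if_pos (show k + q = x.1.1 + x.1.2 by omega), sub_sub]
      by_cases hx : cond x
      · rw [if_pos hx, if_pos (by change _ = _ at hx; omega)]
      · rw [if_neg hx, if_neg fun h => hx (by change _ = _; omega), mul_zero]
    · rw [if_neg hq, if_neg (fun h => hq (by omega)), zero_mul]
  · refine hasSum_sum fun x _ => HasSum.mul_left _ ?_
    split_ifs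
    · exact hasSum_autocorrelation ht _ _
    · exact hasSum_zero
  · simp only [hG, hG', linearCombination_mul_linearCombination]
    refine hasSum_sum fun x _ => HasSum.mul_left _ ?_
    refine (congrArg (HasSum · _) (funext fun k => ?_)).mp (hasSum_ite_eq (x.1.1 + x.1.2 - q) (if cond x then
      (binomCoeffInt t (q - x.1.2) : ℂ) * binomCoeffInt t (q - (n + x.2.2)) else 0))
    symm
    unfold rightKernel
    by_cases hk : k = x.1.1 + x.1.2 - q
    · rw [if_pos hk, if_pos (show k + q = x.1.1 + x.1.2 by omega), sub_sub]
      by_cases hx : cond x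
      · rw [if_pos hx, if_pos (by change _ = _ at hx; omega)]
      · rw [if_neg hx, if_neg fun h => hx (by change _ = _; omega), mul_zero]
    · rw [if_neg hk, if_neg (fun h => hk (by omega)), zero_mul]
  · refine hasSum_sum fun x _ => HasSum.mul_left _ ?_
    split_ifs with h
    -- In the opposite order the shift is n + P'.2 - P.2, which under `cond` is the negative of the
    -- shift m + P'.1 - P.1 of the first order.
    · rw [← autocorrelation_neg, show -(m + x.2.1 - x.1.1) = n + x.2.2 - x.1.2 by
        change _ = _ at h
        linarith]
      exact hasSum_autocorrelation ht _ _
    · exact hasSum_zero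

/-! ### Norm convergence -/

/-- A family of vectors in a Hilbert space each of which is orthogonal to all but a bounded number
of the others is summable if the sum of the square norms converges. -/
theorem summable_of_banded_inner {ι H : Type*} [NormedAddCommGroup H] [InnerProductSpace ℂ H]
    [CompleteSpace H] {x : ι → H} (nb : ι → Finset ι) (M : ℕ) (hM : ∀ i, (nb i).card ≤ M)
    (hnb : ∀ i j, ⟪x i, x j⟫_ℂ ≠ 0 → j ∈ nb i) (hx : Summable fun i => ‖x i‖ ^ 2) :
    Summable x := by
  classical
  have key : ∀ t : Finset ι, ‖∑ i ∈ t, x i‖ ^ 2 ≤ M * ∑ i ∈ t, ‖x i‖ ^ 2 := by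
    intro t
    -- A Schur test with the symmetric incidence matrix of non-orthogonal pairs, whose row sums are
    -- at most M.
    let N : ι → ι → ℝ := fun i j => if ⟪x i, x j⟫_ℂ = 0 then 0 else 1
    have hN : ∀ i, ∑ j ∈ t, N i j ≤ M := fun i => by
      have : ∑ j ∈ t, N i j = ((t.filter fun j => ⟪x i, x j⟫_ℂ ≠ 0).card : ℝ) := by
        rw [Finset.card_filter]
        push_cast
        refine Finset.sum_congr rfl fun j _ => ?_
        simp only [N, ne_eq, ite_not]
      rw [this]
      exact_mod_cast (Finset.card_le_card fun j hj => hnb i j (Finset.mem_filter.1 hj).2).trans (hM i)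
    have hN' : ∀ i j, N i j = N j i := fun i j => by
      simp only [N, inner_eq_zero_symm]
    have h1 : ∀ i j, (⟪x i, x j⟫_ℂ).re ≤ N i j * ((‖x i‖ ^ 2 + ‖x j‖ ^ 2) / 2) := fun i j => by
      by_cases h : ⟪x i, x j⟫_ℂ = 0
      · simp [N, h]
      · simp only [N, h, if_false, one_mul]
        have := (Complex.re_le_norm _).trans (norm_inner_le_norm (𝕜 := ℂ) (x i) (x j))
        nlinarith [sq_nonneg (‖x i‖ - ‖x j‖)]
    calc ‖∑ i ∈ t, x i‖ ^ 2 = ∑ i ∈ t, ∑ j ∈ t, (⟪x i, x j⟫_ℂ).re := by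
          rw [← inner_self_eq_norm_sq (𝕜 := ℂ), sum_inner]
          simp only [inner_sum]
          simp
      _ ≤ ∑ i ∈ t, ∑ j ∈ t, N i j * ((‖x i‖ ^ 2 + ‖x j‖ ^ 2) / 2) :=
          Finset.sum_le_sum fun i _ => Finset.sum_le_sum fun j _ => h1 i j
      _ = (∑ i ∈ t, ∑ j ∈ t, N i j * (‖x i‖ ^ 2 / 2)) +
            ∑ i ∈ t, ∑ j ∈ t, N i j * (‖x j‖ ^ 2 / 2) := by
          rw [← Finset.sum_add_distrib]
          refine Finset.sum_congr rfl fun i _ => ?_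
          rw [← Finset.sum_add_distrib]
          refine Finset.sum_congr rfl fun j _ => ?_
          ring
      _ = ∑ i ∈ t, (∑ j ∈ t, N i j) * ‖x i‖ ^ 2 := by
          rw [Finset.sum_comm (f := fun i j => N i j * (‖x j‖ ^ 2 / 2)), ← Finset.sum_add_distrib]
          refine Finset.sum_congr rfl fun i _ => ?_
          rw [← Finset.sum_add_distrib, Finset.sum_mul]
          refine Finset.sum_congr rfl fun j _ => ?_
          rw [hN' j i]
          ring
      _ ≤ ∑ i ∈ t, M * ‖x i‖ ^ 2 :=
          Finset.sum_le_sum fun i _ => mul_le_mul_of_nonneg_right (hN i) (sq_nonneg _)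
      _ = M * ∑ i ∈ t, ‖x i‖ ^ 2 := by rw [Finset.mul_sum]
  rw [summable_iff_vanishing_norm]
  intro ε hε
  obtain ⟨s, hs⟩ := summable_iff_vanishing_norm.1 hx (ε ^ 2 / (M + 1)) (by positivity)
  refine ⟨s, fun t ht => ?_⟩
  have h1 := (le_abs_self _).trans_lt (hs t ht)
  rw [lt_div_iff₀ (by positivity)] at h1
  have h0 : 0 ≤ ∑ i ∈ t, ‖x i‖ ^ 2 := Finset.sum_nonneg fun i _ => sq_nonneg _
  exact lt_of_pow_lt_pow_left₀ 2 hε.le ((key t).trans_lt (by nlinarith))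

/-- Moving the left mode across turns Gram matrix elements into matrix elements of Y_{-a} Y_a, whose
exponent is t = a². -/
theorem inner_vertexCoeff_vertexCoeff (a : ℝ) (v : Fock) : ∃ p : ℤ × ℤ →₀ ℂ, ∀ k q,
    ⟪vertexCoeff a k v, vertexCoeff a q v⟫_ℂ =
      Finsupp.linearCombination ℂ (leftKernel (a * a) (-k) q) p := by
  obtain ⟨p, hF, -⟩ := isExpansion_inner_vertexCoeff (-a) a v v
  beta_reduce at hF
  rw [neg_mul, neg_neg] at hF
  exact ⟨p, fun k q => by rw [inner_vertexCoeff_left, hF]⟩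

/-- In the first factor the Gram matrix vanishes unless q - k is the total degree of one of finitely
many monomials, which bounds the band. The square norms are finite combinations of products of two
binomial coefficients with t = a² < 1/2. -/
theorem summable_vertexCoeff_tmul {H : Type*} [NormedAddCommGroup H] [InnerProductSpace ℂ H]
    [CompleteSpace H] (ι : Fock ⊗[ℂ] Fock →ₗᵢ[ℂ] H) (a : ℝ) (ha : a * a < 1 / 2) (m : ℤ)
    (v w : Fock) : Summable fun k : ℤ => ι (vertexCoeff a k v ⊗ₜ vertexCoeff a (k - m) w) := by
  classical
  obtain ⟨p, hp⟩ := inner_vertexCoeff_vertexCoeff a v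
  obtain ⟨p', hp'⟩ := inner_vertexCoeff_vertexCoeff a w
  have ha' : |a * a| < 1 / 2 := by rwa [abs_mul_self]
  refine summable_of_banded_inner (fun k => p.support.image fun P => k + (P.1 + P.2))
    p.support.card (fun k => Finset.card_image_le) (fun k q h => ?_) ?_
  · rw [ι.inner_map_map, TensorProduct.inner_tmul] at h
    have h1 := left_ne_zero_of_mul h
    rw [hp, Finsupp.linearCombination_apply] at h1
    obtain ⟨P, hP, h2⟩ := Finset.exists_ne_zero_of_sum_ne_zero h1
    have h3 := right_ne_zero_of_mul h2
    refine Finset.mem_image.2 ⟨P, hP, ?_⟩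
    by_contra h4
    exact h3 (if_neg fun h5 => h4 (by omega))
  · rw [← Complex.summable_ofReal]
    have e : ∀ k : ℤ, ((‖ι (vertexCoeff a k v ⊗ₜ vertexCoeff a (k - m) w)‖ ^ 2 : ℝ) : ℂ) =
        ∑ x ∈ p.support ×ˢ p'.support, p x.1 * p' x.2 *
          (leftKernel (a * a) (-k) k x.1 * leftKernel (a * a) (-(k - m)) (k - m) x.2) := fun k => by
      rw [← linearCombination_mul_linearCombination, ← hp, ← hp', ι.norm_map,
        TensorProduct.norm_tmul, inner_self_eq_norm_sq_to_K, inner_self_eq_norm_sq_to_K, mul_pow]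
      push_cast
      rfl
    simp only [e]
    refine summable_sum fun x _ => Summable.mul_left _ ?_
    simp only [leftKernel, neg_add_cancel]
    split_ifs
    · refine (summable_binomCoeffInt_mul ha' ((Equiv.neg ℤ).trans (Equiv.subRight x.1.1))
        ((Equiv.subRight m).trans ((Equiv.neg ℤ).trans (Equiv.subRight x.2.1)))).congr fun k => ?_
      simp
    all_goals simp

/-! ### The finite vectors in the Hilbert space -/

theorem finiteVectors_induction {P : FiniteVectors → Prop}
    (add : ∀ x y, P x → P y → P (x + y))
    (single : ∀ j v w, P (Finsupp.single j (v ⊗ₜ w))) (x : FiniteVectors) : P x := by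
  have h0 : P 0 := by simpa using single 0 0 0
  induction x using Finsupp.induction_linear with
  | zero => exact h0
  | add x y hx hy => exact add x y hx hy
  | single j u =>
    induction u using TensorProduct.induction_on with
    | zero => simpa using h0
    | tmul v w => exact single j v w
    | add u u' h h' => rw [Finsupp.single_add]; exact add _ _ h h'

theorem incl_single (j : ℤ) (u : Fock ⊗[ℂ] Fock) : incl (Finsupp.single j u) =
    lp.single (E := fun _ : ℤ => UniformSpace.Completion (Fock ⊗[ℂ] Fock)) 2 j
      ((u : Fock ⊗[ℂ] Fock) : UniformSpace.Completion (Fock ⊗[ℂ] Fock)) := by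
  rw [incl, Finsupp.lsum_single]
  rfl

theorem inner_incl_single_left (j : ℤ) (u : Fock ⊗[ℂ] Fock) (f : HilbertSpace) :
    ⟪incl (Finsupp.single j u), f⟫_ℂ =
      ⟪((u : Fock ⊗[ℂ] Fock) : UniformSpace.Completion (Fock ⊗[ℂ] Fock)), f j⟫_ℂ := by
  rw [incl_single, lp.inner_single_left]

theorem inner_incl_single_single (i j : ℤ) (u u' : Fock ⊗[ℂ] Fock) :
    ⟪incl (Finsupp.single i u), incl (Finsupp.single j u')⟫_ℂ = if i = j then ⟪u, u'⟫_ℂ else 0 := by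
  rw [inner_incl_single_left, incl_apply, UniformSpace.Completion.inner_coe]
  split_ifs with h
  · rw [h, Finsupp.single_eq_same]
  · rw [Finsupp.single_eq_of_ne h, inner_zero_right]

/-- The isometric inclusion of one sector of finite vectors. -/
def sectorIncl (j : ℤ) : Fock ⊗[ℂ] Fock →ₗᵢ[ℂ] HilbertSpace where
  toLinearMap := incl ∘ₗ Finsupp.lsingle j
  norm_map' u := by
    change ‖incl (Finsupp.single j u)‖ = ‖u‖
    rw [← sq_eq_sq₀ (norm_nonneg _) (norm_nonneg _), ← inner_self_eq_norm_sq (𝕜 := ℂ),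
      ← inner_self_eq_norm_sq (𝕜 := ℂ), inner_incl_single_single, if_pos rfl]

theorem dense_finiteDomain : Dense (finiteDomain : Set HilbertSpace) := by
  rw [Submodule.dense_iff_topologicalClosure_eq_top, Submodule.topologicalClosure_eq_top_iff,
    Submodule.eq_bot_iff]
  intro f hf
  ext1
  funext j
  refine UniformSpace.Completion.denseRange_coe.eq_zero_of_inner_right ℂ fun u => ?_
  rw [← inner_incl_single_left]
  exact (Submodule.mem_orthogonal _ f).1 hf _ ⟨Finsupp.single j u, rfl⟩

/-! ### The components of the time-zero field -/

theorem shiftedPair_single (α₀ : ℝ) (l : ℤ) (s t : ℝ) (j : ℤ) (v w : Fock) :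
    shiftedPair α₀ l s t (Finsupp.single j (v ⊗ₜ w)) = Finsupp.single (j + l)
      (chargedMode (l * α₀) (j * α₀) s v ⊗ₜ chargedMode (l * α₀) (j * α₀) t w) := by
  rw [shiftedPair, Finsupp.lsum_single]
  rfl

/-- The terms of the component of charge `c α₀` of the time-zero field. -/
def componentTerm (α₀ : ℝ) (c m j : ℤ) (v w : Fock) (k : ℤ) : HilbertSpace :=
  incl (Finsupp.single (j + c)
    (vertexCoeff (c * α₀) k v ⊗ₜ[ℂ] vertexCoeff (c * α₀) (k - m) w))

/-- The component of charge `c α₀` of the time-zero field, on a product vector. -/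
def component (α₀ : ℝ) (c m j : ℤ) (v w : Fock) : HilbertSpace :=
  ∑' k : ℤ, componentTerm α₀ c m j v w k

theorem hasSum_component {α₀ : ℝ} {c : ℤ} (hc : (c * α₀) * (c * α₀) < 1 / 2) (m j : ℤ) (v w : Fock) :
    HasSum (componentTerm α₀ c m j v w) (component α₀ c m j v w) :=
  (summable_vertexCoeff_tmul (sectorIncl (j + c)) (c * α₀) hc m v w).hasSum

/-- Only s in ℤ - aβ - a²/2 contributes. Both tensor factors have the same charge, hence the same
offset, and s and -m + s correspond to the integers k and k - m. -/
theorem hasSum_shiftedPair {α₀ : ℝ} {c : ℤ} (hc : (c * α₀) * (c * α₀) < 1 / 2) (m j : ℤ)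
    (v w : Fock) :
    HasSum (fun s : ℝ => incl (shiftedPair α₀ c s (-m + s) (Finsupp.single j (v ⊗ₜ w))))
      (component α₀ c m j v w) := by
  set a : ℝ := c * α₀ with ha
  set β : ℝ := j * α₀ with hβ
  have hinj : Function.Injective fun k : ℤ => (k : ℝ) - a * β - a ^ 2 / 2 := fun k k' h => by
    simpa using h
  refine (hinj.hasSum_iff fun s hs => ?_).1
    ((hasSum_component hc m j v w).congr_fun fun k => ?_)
  · have : chargedMode a β s = 0 := if_neg fun h => hs ⟨⌊s + a * β + a ^ 2 / 2⌋, by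
      beta_reduce
      rw [h]
      ring⟩
    rw [shiftedPair_single, ← ha, ← hβ, this, LinearMap.zero_apply, TensorProduct.zero_tmul,
      Finsupp.single_zero, map_zero]
  · have e : ∀ (k : ℤ) (s : ℝ), s + a * β + a ^ 2 / 2 = k → chargedMode a β s = vertexCoeff a k :=
      fun k s h => by rw [chargedMode, h, Int.floor_intCast, if_pos rfl]
    rw [Function.comp_apply, shiftedPair_single, ← ha, ← hβ, componentTerm, e k _ (by ring),
      e (k - m) _ (by push_cast; ring)]

theorem hasSum_timeZeroTerm {α₀ : ℝ} {l : ℤ} (hl : (l * α₀) * (l * α₀) < 1 / 2) (m j : ℤ)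
    (v w : Fock) : HasSum (timeZeroTerm α₀ l m (Finsupp.single j (v ⊗ₜ w)))
      (∑ ε : ℤˣ, component α₀ (ε * l) m j v w) := by
  have h : ∀ ε : ℤˣ, HasSum (fun p : ℤˣ × ℝ => if p.1 = ε then
      timeZeroTerm α₀ l m (Finsupp.single j (v ⊗ₜ w)) p else 0) (component α₀ (ε * l) m j v w) := by
    intro ε
    have hε : (((ε : ℤ) * l : ℤ) * α₀) * (((ε : ℤ) * l : ℤ) * α₀) < 1 / 2 := by
      rcases Int.units_eq_one_or ε with rfl | rfl <;> simpa using hl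
    refine ((Prod.mk_right_injective ε).hasSum_iff fun p hp => if_neg fun h => hp ⟨p.2, ?_⟩).1
      ((hasSum_shiftedPair hε m j v w).congr_fun fun s => ?_)
    · rw [← h]
    · rw [Function.comp_apply, if_pos rfl]
      rfl
  refine (hasSum_sum fun ε (_ : ε ∈ Finset.univ) => h ε).congr_fun fun p => ?_
  rw [Finset.sum_ite_eq, if_pos (Finset.mem_univ _)]

theorem convergenceDomain_eq_top {α₀ : ℝ} {l : ℤ} (hl : (l * α₀) * (l * α₀) < 1 / 2) (m : ℤ) :
    convergenceDomain α₀ l m = ⊤ := by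
  rw [eq_top_iff]
  rintro x -
  induction x using finiteVectors_induction with
  | add x y hx hy => exact Submodule.add_mem _ hx hy
  | single j v w => exact (hasSum_timeZeroTerm hl m j v w).summable

/-- The time-zero field on a finite vector. -/
def totalField (α₀ : ℝ) (l m : ℤ) (x : FiniteVectors) : HilbertSpace :=
  ∑' p, timeZeroTerm α₀ l m x p

theorem totalField_add {α₀ : ℝ} {l : ℤ} (hl : (l * α₀) * (l * α₀) < 1 / 2) (m : ℤ)
    (x y : FiniteVectors) :
    totalField α₀ l m (x + y) = totalField α₀ l m x + totalField α₀ l m y := by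
  have h : ∀ x, Summable (timeZeroTerm α₀ l m x) := fun x => by
    have : x ∈ convergenceDomain α₀ l m := by
      rw [convergenceDomain_eq_top hl]
      trivial
    exact this
  rw [totalField, timeZeroTerm_add]
  exact (h x).tsum_add (h y)

theorem totalField_single {α₀ : ℝ} {l : ℤ} (hl : (l * α₀) * (l * α₀) < 1 / 2) (m j : ℤ)
    (v w : Fock) : totalField α₀ l m (Finsupp.single j (v ⊗ₜ w)) =
      ∑ ε : ℤˣ, component α₀ (ε * l) m j v w :=
  (hasSum_timeZeroTerm hl m j v w).tsum_eq

/-! ### Relations between the components -/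

theorem inner_component_right {α₀ : ℝ} {c : ℤ} (hc : (c * α₀) * (c * α₀) < 1 / 2) (m i j : ℤ)
    (v w v' w' : Fock) :
    ⟪incl (Finsupp.single i (v' ⊗ₜ w')), component α₀ c m j v w⟫_ℂ = if i = j + c then
      ∑' k : ℤ, ⟪v', vertexCoeff (c * α₀) k v⟫_ℂ * ⟪w', vertexCoeff (c * α₀) (k - m) w⟫_ℂ else 0 := by
  have h := (hasSum_component hc m j v w).mapL (innerSL ℂ (incl (Finsupp.single i (v' ⊗ₜ w'))))
  rw [innerSL_apply_apply] at h
  rw [← h.tsum_eq]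
  simp only [innerSL_apply_apply, componentTerm, inner_incl_single_single, TensorProduct.inner_tmul]
  split_ifs
  · rfl
  · exact tsum_zero

theorem inner_component_left {α₀ : ℝ} {c : ℤ} (hc : (c * α₀) * (c * α₀) < 1 / 2) (m i j : ℤ)
    (v w v' w' : Fock) :
    ⟪component α₀ c m j v w, incl (Finsupp.single i (v' ⊗ₜ w'))⟫_ℂ = if j + c = i then
      ∑' k : ℤ, ⟪vertexCoeff (c * α₀) k v, v'⟫_ℂ * ⟪vertexCoeff (c * α₀) (k - m) w, w'⟫_ℂ else 0 := by
  have h := (hasSum_component hc m j v w).mapL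
    ((innerSL ℂ (E := HilbertSpace)).flip (incl (Finsupp.single i (v' ⊗ₜ w'))))
  rw [ContinuousLinearMap.flip_apply, innerSL_apply_apply] at h
  rw [← h.tsum_eq]
  simp only [ContinuousLinearMap.flip_apply, innerSL_apply_apply, componentTerm,
    inner_incl_single_single, TensorProduct.inner_tmul]
  split_ifs
  · rfl
  · exact tsum_zero

theorem inner_component_adjoint {α₀ : ℝ} {c : ℤ} (hc : (c * α₀) * (c * α₀) < 1 / 2) (m i j : ℤ)
    (v w v' w' : Fock) :
    ⟪component α₀ (-c) (-m) i v' w', incl (Finsupp.single j (v ⊗ₜ w))⟫_ℂ =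
      ⟪incl (Finsupp.single i (v' ⊗ₜ w')), component α₀ c m j v w⟫_ℂ := by
  rw [inner_component_right hc, inner_component_left (by simpa using hc)]
  refine if_congr (by omega) ?_ rfl
  rw [← (Equiv.neg ℤ).tsum_eq]
  refine tsum_congr fun k => ?_
  rw [Equiv.neg_apply, inner_vertexCoeff_left, inner_vertexCoeff_left]
  push_cast
  rw [neg_mul, neg_neg, neg_neg, show -(-k - -m) = k - m by ring]

/-- The components of the time-zero field commute. -/
theorem inner_component_component {α₀ : ℝ} {c c' : ℤ} (hc : (c * α₀) * (c * α₀) < 1 / 2)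
    (hc' : (c' * α₀) * (c' * α₀) < 1 / 2) (m n i j : ℤ) (v w v' w' : Fock) :
    ⟪component α₀ c' (-m) i v' w', component α₀ c n j v w⟫_ℂ =
      ⟪component α₀ (-c) (-n) i v' w', component α₀ (-c') m j v w⟫_ℂ := by
  -- Arithmetic-geometric mean of the two squares.
  have hab : |(-(c' * α₀)) * (c * α₀)| < 1 / 2 := by
    rw [abs_lt]
    constructor <;> nlinarith [sq_nonneg (c * α₀ - c' * α₀), sq_nonneg (c * α₀ + c' * α₀)]
  obtain ⟨R, R', T, hR, hT, hR', hT'⟩ :=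
    exists_hasSum_vertexCoeff_comm (-(c' * α₀)) (c * α₀) hab m n v' v w' w
  have hneg : ∀ d : ℤ, (d * α₀) * (d * α₀) < 1 / 2 → (((-d : ℤ) : ℝ) * α₀) * ((-d : ℤ) * α₀) < 1 / 2 :=
    fun d h => by simpa using h
  have h1 := (hasSum_component hc' (-m) i v' w').mapL
    ((innerSL ℂ (E := HilbertSpace)).flip (component α₀ c n j v w))
  have h2 := (hasSum_component (hneg c hc) (-n) i v' w').mapL
    ((innerSL ℂ (E := HilbertSpace)).flip (component α₀ (-c') m j v w))
  simp only [ContinuousLinearMap.flip_apply, innerSL_apply_apply, componentTerm] at h1 h2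
  rw [← h1.tsum_eq, ← h2.tsum_eq]
  simp only [inner_component_right hc, inner_component_right (hneg c' hc')]
  by_cases hij : i + c' = j + c
  -- Moving the left component across negates its mode index. The two sides become the iterated
  -- sums, in opposite orders, of `exists_hasSum_vertexCoeff_comm`, with the common value T.
  · rw [← (Equiv.neg ℤ).hasSum_iff] at hT hT'
    refine (Eq.trans (tsum_congr fun k => ?_) hT.tsum_eq).trans
      (Eq.trans (tsum_congr fun q => ?_) hT'.tsum_eq).symm
    · rw [if_pos hij, Function.comp_apply, Equiv.neg_apply, ← (hR (-k)).tsum_eq]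
      refine tsum_congr fun q => ?_
      rw [inner_vertexCoeff_left, inner_vertexCoeff_left, show -(k - -m) = -k - m by ring]
    · rw [if_pos (by omega), Function.comp_apply, Equiv.neg_apply, ← (hR' (-q)).tsum_eq]
      refine tsum_congr fun k => ?_
      rw [inner_vertexCoeff_left, inner_vertexCoeff_left, show -(q - -n) = -q - n by ring]
      push_cast
      rw [neg_mul, neg_mul, neg_neg]
  · simp only [if_neg hij, if_neg (show ¬ i + -c = j + -c' by omega)]

theorem undeformed_single (α₀ : ℝ) (m j : ℤ) (v w : Fock) :
    undeformed α₀ m (Finsupp.single j (v ⊗ₜ w)) =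
      Finsupp.single j (sugawara (j * α₀) m v ⊗ₜ w) +
        (-1 : ℂ) • Finsupp.single j (v ⊗ₜ sugawara (j * α₀) (-m) w) := by
  rw [undeformed, Finsupp.lsum_single, LinearMap.comp_apply, LinearMap.sub_apply,
    TensorProduct.map_tmul, TensorProduct.map_tmul, sub_eq_add_neg, ← neg_one_smul ℂ, map_add,
    map_smul]
  rfl

theorem summable_inner_vertexCoeff_mul (a : ℝ) (v w : Fock) (f : ℤ → ℂ) :
    Summable fun k : ℤ => ⟪v, vertexCoeff a k w⟫_ℂ * f k :=
  summable_of_hasFiniteSupport ((inner_vertexCoeff_finite a v w).subset fun k hk h => hk (by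
    change _ * _ = _
    have h' : ⟪v, vertexCoeff a k w⟫_ℂ = 0 := h
    rw [h', zero_mul]))

/-- The components of the time-zero field are primary. -/
theorem inner_undeformed_component {α₀ : ℝ} {c : ℤ} (hc : (c * α₀) * (c * α₀) < 1 / 2)
    (m n i j : ℤ) (v w v' w' : Fock) :
    ⟪incl (undeformed α₀ (-m) (Finsupp.single i (v' ⊗ₜ w'))), component α₀ c n j v w⟫_ℂ -
      ⟪component α₀ (-c) (-n) i v' w', incl (undeformed α₀ m (Finsupp.single j (v ⊗ₜ w)))⟫_ℂ =
      ((((c : ℂ) * α₀) ^ 2 - 1) * m - n) *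
        ⟪incl (Finsupp.single i (v' ⊗ₜ w')), component α₀ c (m + n) j v w⟫_ℂ := by
  simp only [undeformed_single, map_add, map_smul, inner_add_left, inner_add_right,
    inner_smul_left, inner_smul_right, inner_component_adjoint hc, inner_component_right hc,
    map_neg, map_one, neg_neg, neg_one_mul, ← sub_eq_add_neg]
  by_cases hij : i = j + c
  swap
  · simp [hij]
  have hi : (i * α₀ : ℝ) = j * α₀ + c * α₀ := by
    rw [hij]
    push_cast
    ring
  simp only [if_pos hij]
  rw [hi]
  set a : ℝ := c * α₀ with ha
  set β : ℝ := j * α₀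
  have e1 : ∀ k : ℤ, ⟪sugawara (β + a) (-m) v', vertexCoeff a k v⟫_ℂ =
      ⟪v', vertexCoeff a k (sugawara β m v)⟫_ℂ +
        (((a : ℂ) ^ 2 / 2 - 1) * m - k + a * β + a ^ 2 / 2) * ⟪v', vertexCoeff a (k + m) v⟫_ℂ := by
    intro k
    rw [inner_sugawara_left, neg_neg, sugawara_vertexCoeff, inner_add_right, inner_smul_right]
  have e2 : ∀ k : ℤ, ⟪sugawara (β + a) m w', vertexCoeff a k w⟫_ℂ =
      ⟪w', vertexCoeff a k (sugawara β (-m) w)⟫_ℂ +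
        (((a : ℂ) ^ 2 / 2 - 1) * (-m) - k + a * β + a ^ 2 / 2) * ⟪w', vertexCoeff a (k - m) w⟫_ℂ := by
    intro k
    rw [inner_sugawara_left, sugawara_vertexCoeff, inner_add_right, inner_smul_right]
    push_cast
    rfl
  -- All four series have finite support through their first factor, so they may be split and
  -- recombined term by term.
  have s1 := summable_inner_vertexCoeff_mul a (sugawara (β + a) (-m) v') v
    (fun k => ⟪w', vertexCoeff a (k - n) w⟫_ℂ)
  have s3 := summable_inner_vertexCoeff_mul a v' (sugawara β m v)
    (fun k => ⟪w', vertexCoeff a (k - n) w⟫_ℂ)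
  have s2 := summable_inner_vertexCoeff_mul a v' v
    (fun k => ⟪sugawara (β + a) m w', vertexCoeff a (k - n) w⟫_ℂ)
  have s4 := summable_inner_vertexCoeff_mul a v' v
    (fun k => ⟪w', vertexCoeff a (k - n) (sugawara β (-m) w)⟫_ℂ)
  have d1 : (∑' k : ℤ, ⟪sugawara (β + a) (-m) v', vertexCoeff a k v⟫_ℂ *
      ⟪w', vertexCoeff a (k - n) w⟫_ℂ) -
      ∑' k : ℤ, ⟪v', vertexCoeff a k (sugawara β m v)⟫_ℂ * ⟪w', vertexCoeff a (k - n) w⟫_ℂ =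
      ∑' k : ℤ, ⟪v', vertexCoeff a k v⟫_ℂ * ((((a : ℂ) ^ 2 / 2 - 1) * m - (k - m) + a * β + a ^ 2 / 2) *
        ⟪w', vertexCoeff a (k - (m + n)) w⟫_ℂ) := by
    rw [← s1.tsum_sub s3, ← (Equiv.addRight m).tsum_eq (fun k => ⟪v', vertexCoeff a k v⟫_ℂ *
      ((((a : ℂ) ^ 2 / 2 - 1) * m - (k - m) + a * β + a ^ 2 / 2) *
        ⟪w', vertexCoeff a (k - (m + n)) w⟫_ℂ))]
    refine tsum_congr fun k => ?_
    rw [e1, Equiv.coe_addRight, show k + m - (m + n) = k - n by ring]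
    push_cast
    ring
  have d2 : (∑' k : ℤ, ⟪v', vertexCoeff a k v⟫_ℂ *
      ⟪sugawara (β + a) m w', vertexCoeff a (k - n) w⟫_ℂ) -
      ∑' k : ℤ, ⟪v', vertexCoeff a k v⟫_ℂ * ⟪w', vertexCoeff a (k - n) (sugawara β (-m) w)⟫_ℂ =
      ∑' k : ℤ, ⟪v', vertexCoeff a k v⟫_ℂ *
        ((((a : ℂ) ^ 2 / 2 - 1) * (-m) - (k - n) + a * β + a ^ 2 / 2) *
        ⟪w', vertexCoeff a (k - (m + n)) w⟫_ℂ) := by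
    rw [← s2.tsum_sub s4]
    refine tsum_congr fun k => ?_
    rw [e2, show k - (m + n) = k - n - m by ring]
    push_cast
    ring
  -- The dependence on k and β cancels between the tensor factors: with d = a²/2, the weights (d -
  -- 1)m - k + m + aβ + d and -(d - 1)m - k + n + aβ + d differ by (a² - 1)m - n.
  rw [sub_sub_sub_comm, d1, d2, ← (summable_inner_vertexCoeff_mul a v' v _).tsum_sub
    (summable_inner_vertexCoeff_mul a v' v _), ← tsum_mul_left]
  refine tsum_congr fun k => ?_
  rw [ha]
  push_cast
  ring

/-! ### Relations between the operators -/

theorem inner_totalField_adjoint {α₀ : ℝ} {l : ℤ} (hl : (l * α₀) * (l * α₀) < 1 / 2) (m : ℤ)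
    (x y : FiniteVectors) :
    ⟪totalField α₀ l (-m) y, incl x⟫_ℂ = ⟪incl y, totalField α₀ l m x⟫_ℂ := by
  induction x using finiteVectors_induction with
  | add x x' h h' => rw [map_add, totalField_add hl, inner_add_right, inner_add_right, h, h']
  | single j v w =>
    induction y using finiteVectors_induction with
    | add x x' h h' => rw [map_add, totalField_add hl, inner_add_left, inner_add_left, h, h']
    | single i v' w' =>
      -- The adjoint reverses the charge, so the signs ε are paired with -ε.
      rw [totalField_single hl, totalField_single hl, sum_inner, inner_sum, ← Equiv.sum_comp (Equiv.neg ℤˣ)]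
      refine Finset.sum_congr rfl fun ε _ => ?_
      rw [Equiv.neg_apply, Units.val_neg, neg_mul]
      refine inner_component_adjoint ?_ m i j v w v' w'
      rcases Int.units_eq_one_or ε with rfl | rfl <;> simpa using hl

theorem inner_undeformed_totalField {α₀ : ℝ} {l : ℤ} (hl : (l * α₀) * (l * α₀) < 1 / 2) (m n : ℤ)
    (x y : FiniteVectors) :
    ⟪incl (undeformed α₀ (-m) y), totalField α₀ l n x⟫_ℂ -
      ⟪totalField α₀ l (-n) y, incl (undeformed α₀ m x)⟫_ℂ =
      ((((l : ℂ) * α₀) ^ 2 - 1) * m - n) * ⟪incl y, totalField α₀ l (m + n) x⟫_ℂ := by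
  induction x using finiteVectors_induction with
  | add x x' h h' =>
    simp only [map_add, totalField_add hl, inner_add_right]
    linear_combination h + h'
  | single j v w =>
    induction y using finiteVectors_induction with
    | add x x' h h' =>
      simp only [map_add, totalField_add hl, inner_add_left]
      linear_combination h + h'
    | single i v' w' =>
      simp only [totalField_single hl, sum_inner, inner_sum]
      rw [← Equiv.sum_comp (Equiv.neg ℤˣ) (fun ε : ℤˣ => ⟪component α₀ (ε * l) (-n) i v' w',
        incl (undeformed α₀ m (Finsupp.single j (v ⊗ₜ w)))⟫_ℂ), ← Finset.sum_sub_distrib,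
        Finset.mul_sum]
      refine Finset.sum_congr rfl fun ε _ => ?_
      have hε : (((ε : ℤ) * l : ℤ) * α₀) * (((ε : ℤ) * l : ℤ) * α₀) < 1 / 2 := by
        rcases Int.units_eq_one_or ε with rfl | rfl <;> simpa using hl
      rw [Equiv.neg_apply, Units.val_neg, neg_mul, inner_undeformed_component hε]
      congr 2
      rcases Int.units_eq_one_or ε with rfl | rfl <;> simp

theorem inner_totalField_totalField {α₀ : ℝ} {l : ℤ} (hl : (l * α₀) * (l * α₀) < 1 / 2) (m n : ℤ)
    (x y : FiniteVectors) :
    ⟪totalField α₀ l (-m) y, totalField α₀ l n x⟫_ℂ =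
      ⟪totalField α₀ l (-n) y, totalField α₀ l m x⟫_ℂ := by
  induction x using finiteVectors_induction with
  | add x x' h h' => simp only [totalField_add hl, inner_add_right, h, h']
  | single j v w =>
    induction y using finiteVectors_induction with
    | add x x' h h' => simp only [totalField_add hl, inner_add_left, h, h']
    | single i v' w' =>
      have hε : ∀ ε : ℤˣ, (((ε : ℤ) * l : ℤ) * α₀) * (((ε : ℤ) * l : ℤ) * α₀) < 1 / 2 := fun ε => by
        rcases Int.units_eq_one_or ε with rfl | rfl <;> simpa using hl
      simp only [totalField_single hl, sum_inner, inner_sum]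
      rw [Finset.sum_comm, ← Equiv.sum_comp (Equiv.neg ℤˣ) (fun ε : ℤˣ => ∑ ε' : ℤˣ,
        ⟪component α₀ (ε' * l) (-n) i v' w', component α₀ (ε * l) m j v w⟫_ℂ)]
      refine Finset.sum_congr rfl fun ε _ => ?_
      rw [← Equiv.sum_comp (Equiv.neg ℤˣ) (fun ε' : ℤˣ => ⟪component α₀ (ε' * l) (-n) i v' w',
        component α₀ (_ * l) m j v w⟫_ℂ)]
      refine Finset.sum_congr rfl fun ε' _ => ?_
      simp only [Equiv.neg_apply, Units.val_neg, neg_mul]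
      exact inner_component_component (hε _) (hε _) m n i j v w v' w'

theorem inner_undeformed (α₀ : ℝ) (m : ℤ) (x y : FiniteVectors) :
    ⟪incl (undeformed α₀ (-m) y), incl x⟫_ℂ = ⟪incl y, incl (undeformed α₀ m x)⟫_ℂ := by
  induction x using finiteVectors_induction with
  | add x x' h h' => simp only [map_add, inner_add_right, h, h']
  | single j v w =>
    induction y using finiteVectors_induction with
    | add x x' h h' => simp only [map_add, inner_add_left, h, h']
    | single i v' w' =>
      simp only [undeformed_single, map_add, map_smul, inner_add_left, inner_add_right,
        inner_smul_left, inner_smul_right, map_neg, map_one, inner_incl_single_single, TensorProduct.inner_tmul, neg_neg]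
      by_cases h : i = j
      · subst h
        simp only [if_true, inner_sugawara_left, neg_neg]
      · simp [h]

/-- The second factor carries the modes -m and -n, so its central term is the opposite of that of
the first. This is why the total central charge is 0. -/
theorem undeformed_commutator (α₀ : ℝ) (m n : ℤ) (x : FiniteVectors) :
    undeformed α₀ m (undeformed α₀ n x) = undeformed α₀ n (undeformed α₀ m x) +
      ((m : ℂ) - n) • undeformed α₀ (m + n) x := by
  induction x using finiteVectors_induction with
  | add x x' h h' => simp only [map_add, smul_add, h, h']; abel
  | single j v w =>
    simp only [undeformed_single, map_add, map_smul]
    have h1 := sugawara_commutator (j * α₀) m n v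
    have h2 := sugawara_commutator (j * α₀) (-m) (-n) w
    rw [sub_eq_iff_eq_add] at h1 h2
    rw [h1, h2, centralTerm_neg, show -m + -n = -(m + n) by ring]
    simp only [TensorProduct.add_tmul, TensorProduct.tmul_add,
      ← TensorProduct.smul_tmul', TensorProduct.tmul_smul, Finsupp.single_add, ← Finsupp.smul_single]
    push_cast
    module

theorem deformed_apply {α₀ : ℝ} {l : ℤ} (lam : ℂ) (m : ℤ) (x : FiniteVectors)
    (hx : incl x ∈ (deformed α₀ l lam m).domain) :
    deformed α₀ l lam m ⟨incl x, hx⟩ =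
      incl (undeformed α₀ m x) + (Complex.I * lam * m) • totalField α₀ l m x := by
  obtain ⟨x', hx', h⟩ := id hx
  obtain rfl := incl_injective h
  have e : ((convergenceDomain α₀ l m).equivMapOfInjective incl incl_injective).symm ⟨incl x', hx⟩ =
      ⟨x', hx'⟩ := by
    rw [LinearEquiv.symm_apply_eq]
    rfl
  change (incl ∘ₗ undeformed α₀ m ∘ₗ (convergenceDomain α₀ l m).subtype +
      (Complex.I * lam * m) • timeZeroField α₀ l m)
      (((convergenceDomain α₀ l m).equivMapOfInjective incl incl_injective).symm ⟨incl x', hx⟩) = _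
  rw [e]
  rfl

theorem deformed_domain {α₀ : ℝ} {l : ℤ} (hl : (l * α₀) * (l * α₀) < 1 / 2) (lam : ℂ) (m : ℤ) :
    (deformed α₀ l lam m).domain = finiteDomain := by
  change (convergenceDomain α₀ l m).map incl = _
  rw [convergenceDomain_eq_top hl, Submodule.map_top]
  rfl

/-- Exhibits the vector that represents the adjoint on D; this yields both the inclusion of D in the
adjoint domain and the value of the adjoint there. -/
theorem inner_deformed {α₀ : ℝ} {l : ℤ} (hl : (l * α₀) * (l * α₀) < 1 / 2) (lam : ℂ) (m : ℤ)
    (y : FiniteVectors) (Ψ : (deformed α₀ l lam m).domain) :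
    ⟪incl (undeformed α₀ (-m) y) + starRingEnd ℂ (Complex.I * lam * m) • totalField α₀ l (-m) y,
      (Ψ : HilbertSpace)⟫_ℂ = ⟪incl y, deformed α₀ l lam m Ψ⟫_ℂ := by
  obtain ⟨Ψ, hΨ⟩ := Ψ
  obtain ⟨x, hx, rfl⟩ := id hΨ
  rw [deformed_apply, inner_add_left, inner_add_right, inner_smul_left, inner_smul_right,
    inner_undeformed, inner_totalField_adjoint hl, Complex.conj_conj]

end TimeZero

end

/-! ### The weak Witt relations for the deformed operators. -/

theorem mainTheorem4 (α₀ : ℝ) (hα₀ : α₀ ≠ 0) (hα₀_le : |α₀| ≤ 1)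
    (l : ℤ) (hα : |(l : ℝ) * α₀| < 1 / Real.sqrt 2) (lam : ℂ) :
    TimeZero.WeakVirasoroRelations 0 TimeZero.finiteDomain (TimeZero.deformed α₀ l lam) := by
  open TimeZero in
  have hl : ((l : ℝ) * α₀) * (l * α₀) < 1 / 2 := by
    have h := mul_self_lt_mul_self (abs_nonneg _) hα
    rw [abs_mul_abs_self, div_mul_div_comm, one_mul, Real.mul_self_sqrt (by norm_num)] at h
    exact h
  have hdense : ∀ m, Dense ((deformed α₀ l lam m).domain : Set HilbertSpace) := fun m => by
    rw [deformed_domain hl]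
    exact dense_finiteDomain
  have hadj : ∀ m, finiteDomain ≤ (deformed α₀ l lam m)†.domain := by
    rintro m _ ⟨y, rfl⟩
    exact LinearPMap.mem_adjoint_domain_of_exists _ ⟨_, inner_deformed hl lam m y⟩
  refine ⟨dense_finiteDomain, deformed_domain hl lam, hadj, ?_⟩
  rintro m n _ _ ⟨y, rfl⟩ ⟨x, rfl⟩
  have e : ∀ m, (deformed α₀ l lam m)† ⟨incl y, hadj m ⟨y, rfl⟩⟩ =
      incl (undeformed α₀ (-m) y) + starRingEnd ℂ (Complex.I * lam * m) • totalField α₀ l (-m) y :=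
    fun m => LinearPMap.adjoint_apply_eq (hdense m) _ (inner_deformed hl lam m y)
  rw [e, e, deformed_apply, deformed_apply, deformed_apply]
  simp only [inner_add_left, inner_add_right, inner_smul_left, inner_smul_right, Complex.conj_conj]
  have h1 := inner_undeformed_totalField hl m n x y
  have h2 := inner_undeformed_totalField hl n m x y
  have h3 := inner_totalField_totalField hl m n x y
  have h4 : ⟪incl (undeformed α₀ (-m) y), incl (undeformed α₀ n x)⟫_ℂ -
      ⟪incl (undeformed α₀ (-n) y), incl (undeformed α₀ m x)⟫_ℂ =
      ((m : ℂ) - n) * ⟪incl y, incl (undeformed α₀ (m + n) x)⟫_ℂ := by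
    rw [inner_undeformed, inner_undeformed, undeformed_commutator, map_add, inner_add_right,
      add_sub_cancel_left, map_smul, inner_smul_right]
  rw [add_comm n m] at h2
  simp only [zero_div, zero_mul, ite_self, add_zero]
  push_cast
  -- The W-coefficient is iλ[n((α² - 1)m - n) - m((α² - 1)n - m)] = iλ(m² - n²), where α = l α₀; the
  -- part quadratic in λ vanishes by commutativity.
  linear_combination h4 + Complex.I * lam * n * h1 - Complex.I * lam * m * h2 +
    Complex.I * lam * m * (Complex.I * lam * n) * h3
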